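/- **Setting.** Let $p$ be a prime and let $\mathfrak G$ be a $p$-adic Vilenkin group: an abelian topological group (written additively) with compact open subgroups $\cdots\supset\mathfrak G_{-1}\supset\mathfrak G_0\supset\mathfrak G_1\supset\cdots$ forming a base of neighbourhoods of $0$, with $\bigcup_n\mathfrak G_n=\mathfrak G$, $\bigcap_n\mathfrak G_n=\{0\}$, $[\mathfrak G_n:\mathfrak G_{n+1}]=p$, and with elements $g_n\in\mathfrak G_n\setminus\mathfrak G_{n+1}$ satisfying $pg_n=0$ $(n\in\mathbb Z)$. Every $x\in\mathfrak G$ is uniquely $x=\sum_{n\in\mathbb Z}a_ng_n$ with $a_n\in\{0,\dots,p-1\}$ and $a_n=0$ for all sufficiently negative $n$. The dilation operator is the automorphism $\mathcal A\bigl(\sum_n a_ng_n\bigr)=\sum_n a_ng_{n-1}$. Let $H_0$ be the set of all $a_{-1}g_{-1}+\dots+a_{-s}g_{-s}$, $s\in\mathbb N$, $a_j\in\{0,\dots,p-1\}$. Let $X$ be the group of continuous characters of $\mathfrak G$, with values written $(\chi,x)$, let $\mathfrak G_n^\perp=\{\chi\in X:(\chi,x)=1\ \forall x\in\mathfrak G_n\}$,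 let $\chi\mathcal A^{j}$ be the character $(\chi\mathcal A^{j},x)=(\chi,\mathcal A^{j}x)$ for $j\in\mathbb Z$, and let $r_n\in X$ be the Rademacher function $\bigl(r_n,\sum_k a_kg_k\bigr)=\exp(2\pi i a_n/p)$. Let $\mu,\nu$ be the Haar measures on $\mathfrak G$ and $X$ with $\mu(\mathfrak G_0)=\nu(\mathfrak G_0^\perp)=1$. The Fourier transform of $f\in L_2(\mathfrak G)$ is $\hat f(\chi)=\lim_{n\to\infty}\int_{\mathfrak G_{-n}}f(x)\overline{(\chi,x)}\,d\mu(x)$, the limit being in the norm of $L_2(X)$. For $M,N\ge 0$, $\mathfrak D_M(\mathfrak G_{-N})$ is the set of $f\in L_2(\mathfrak G)$ that vanish outside $\mathfrak G_{-N}$ and are constant on the cosets of $\mathfrak G_M$. A family of closed subspaces $V_n\subset L_2(\mathfrak G)$, $n\in\mathbb Z$, is a multiresolution analysis (MRA) if: (A1) $V_n\subset V_{n+1}$; (A2) $\overline{\bigcup_n V_n}=L_2(\mathfrak G)$ and $\bigcap_nV_n=\{0\}$; (A3) $f(x)\in V_n\iff f(\mathcal Ax)\in V_{n+1}$; (A4)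 $f(x)\in V_0$ implies $f(x-h)\in V_0$ for all $h\in H_0$; (A5) for some $\psi\in L_2(\mathfrak G)$ the system $(\psi(x-h))_{h\in H_0}$ is an orthonormal basis of $V_0$. A function $\varphi\in L_2(\mathfrak G)$ generates an orthogonal MRA if $(\varphi(x-h))_{h\in H_0}$ is an orthonormal system and the closed linear spans $V_j$ of $(\varphi(\mathcal A^jx-h))_{h\in H_0}$, $j\in\mathbb Z$, form an MRA. **Theorem.** Let $M,N\ge 0$ be integers and let $m_0:X\to\mathbb C$ satisfy * (T1) $m_0$ is constant on each coset $\mathfrak G_{-N}^\perp\zeta$, $\zeta\in X$; * (T2) $m_0(\chi\, r_1^{\alpha_1}\cdots r_s^{\alpha_s})=m_0(\chi)$ for all $\chi\in X$, all $s$ and all $\alpha_j\in\{0,\dots,p-1\}$; * (T3) $m_0=1$ on $\mathfrak G_{-N}^\perp$; * $m_0(\chi)\,m_0(\chi\mathcal A^{-1})\cdots m_0(\chi\mathcal A^{-M-N})=0$ for all $\chi\in\mathfrak G_{M+1}^\perp\setminus\mathfrak G_M^\perp$. Put $\Phi(\chi)=\prod_{n=0}^\infty m_0(\chi\mathcal A^{-n})$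 (for each $\chi$ all but finitely many factors equal $1$), and suppose that for all $\alpha_{-N},\dots,\alpha_{-1}\in\{0,\dots,p-1\}$ $$\sum_{\alpha_0,\dots,\alpha_{M-1}=0}^{p-1}\bigl|\Phi\bigl(r_{-N}^{\alpha_{-N}}\cdots r_{-1}^{\alpha_{-1}}r_0^{\alpha_0}\cdots r_{M-1}^{\alpha_{M-1}}\bigr)\bigr|^2=1 .$$ Then there is exactly one $\varphi\in L_2(\mathfrak G)$ with $\hat\varphi=\Phi$; it belongs to $\mathfrak D_M(\mathfrak G_{-N})$ and generates an orthogonal MRA of $L_2(\mathfrak G)$. -/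

import Mathlib

set_option linter.unusedSectionVars false

open MeasureTheory Filter Topology
open scoped ENNReal ComplexConjugate

/-- A `p`-adic Vilenkin group: a zero-dimensional locally compact abelian group `G` whose topology
is given by a basic chain `⋯ ⊃ G_{-1} ⊃ G_0 ⊃ G_1 ⊃ ⋯` of compact open subgroups with
`[G_n : G_{n+1}] = p` for all `n`, `⋃ G_n = G`, `⋂ G_n = 0`, together with a basic system
`g_n ∈ G_n \ G_{n+1}` such that `p g_n = 0` for all `n`. -/
structure VilenkinStructure (p : ℕ) (G : Type*) [AddCommGroup G] [TopologicalSpace G] where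
  /-- the chain of subgroups `G_n` -/
  sub : ℤ → AddSubgroup G
  sub_succ_le : ∀ n, sub (n + 1) ≤ sub n
  exists_mem_sub : ∀ x, ∃ n, x ∈ sub n
  eq_zero_of_forall_mem : ∀ x, (∀ n, x ∈ sub n) → x = 0
  hasBasis_nhds_zero : (𝓝 (0 : G)).HasBasis (fun _ : ℤ => True) (fun n => (sub n : Set G))
  isCompact_sub : ∀ n, IsCompact (sub n : Set G)
  relIndex_sub : ∀ n, (sub (n + 1)).relIndex (sub n) = p
  /-- the basic system `g_n` -/
  g : ℤ → G
  g_mem : ∀ n, g n ∈ sub n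
  g_notMem : ∀ n, g n ∉ sub (n + 1)
  p_smul_g : ∀ n, p • g n = 0

namespace VilenkinStructure

section Expansion

variable {p : ℕ} [Fact p.Prime] {G : Type*} [AddCommGroup G] [TopologicalSpace G]
  [IsTopologicalAddGroup G] (V : VilenkinStructure p G)

/-- `x = ∑ₙ aₙ gₙ` with digits `aₙ ∈ {0, …, p - 1}`, only finitely many of the digits with
negative index being nonzero. -/
def IsExpansion (a : ℤ → ZMod p) (x : G) : Prop :=
  (∃ m, ∀ n < m, a n = 0) ∧ HasSum (fun n => (a n).val • V.g n) x

theorem sub_anti {m n : ℤ} (h : m ≤ n) : V.sub n ≤ V.sub m := by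
  obtain ⟨k, rfl⟩ := Int.le.dest h
  induction k with
  | zero => simp
  | succ k ih =>
    refine le_trans ?_ (ih (by omega))
    have := V.sub_succ_le (m + k)
    push_cast
    rwa [← add_assoc]

theorem isOpen_sub (n : ℤ) : IsOpen (V.sub n : Set G) :=
  (V.sub n).isOpen_of_mem_nhds (V.hasBasis_nhds_zero.mem_of_mem trivial)

theorem isClosed_sub (n : ℤ) : IsClosed (V.sub n : Set G) :=
  (V.sub n).isClosed_of_isOpen (V.isOpen_sub n)

theorem t2Space (V : VilenkinStructure p G) : T2Space G := by
  apply IsTopologicalAddGroup.t2Space_of_zero_sep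
  intro x hx
  by_contra h
  push Not at h
  exact hx (V.eq_zero_of_forall_mem x fun n =>
    h _ (V.hasBasis_nhds_zero.mem_of_mem (i := n) trivial))

theorem term_mem {a : ℤ → ZMod p} {k n : ℤ} (ha : ∀ n < k, a n = 0) :
    (a n).val • V.g n ∈ V.sub k := by
  rcases lt_or_ge n k with h | h
  · simp [ha n h]
  · exact (V.sub k).nsmul_mem (V.sub_anti h (V.g_mem n)) _

theorem exists_digit (n : ℤ) {y : G} (hy : y ∈ V.sub n) :
    ∃ c : ZMod p, y - c.val • V.g n ∈ V.sub (n + 1) := by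
  have hcard : Nat.card (V.sub n ⧸ (V.sub (n + 1)).addSubgroupOf (V.sub n)) = p :=
    V.relIndex_sub n
  have hne : ((⟨V.g n, V.g_mem n⟩ : V.sub n) :
      V.sub n ⧸ (V.sub (n + 1)).addSubgroupOf (V.sub n)) ≠ 0 := by
    rw [Ne, QuotientAddGroup.eq_zero_iff, AddSubgroup.mem_addSubgroupOf]
    exact V.g_notMem n
  obtain ⟨k, hk⟩ := mem_multiples_of_prime_card
    (g' := ((⟨y, hy⟩ : V.sub n) : V.sub n ⧸ (V.sub (n + 1)).addSubgroupOf (V.sub n))) hcard hne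
  have hk' : (((k • (⟨V.g n, V.g_mem n⟩ : V.sub n) : V.sub n)) :
      V.sub n ⧸ (V.sub (n + 1)).addSubgroupOf (V.sub n)) = ((⟨y, hy⟩ : V.sub n)) := hk
  rw [QuotientAddGroup.eq, AddSubgroup.mem_addSubgroupOf] at hk'
  refine ⟨(k : ZMod p), ?_⟩
  have h1 : ((k : ZMod p)).val • V.g n = k • V.g n := by
    conv_rhs => rw [← Nat.mod_add_div k p, add_smul, mul_comm, mul_smul, V.p_smul_g, smul_zero,
      add_zero]
    rw [ZMod.val_natCast]
  rw [h1, sub_eq_neg_add]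
  simpa using hk'

theorem hasSum_of {m : ℤ} {a : ℤ → ZMod p} {x : G} (ha : ∀ n < m, a n = 0)
    (h : ∀ K : ℕ, x - ∑ k ∈ Finset.range K, (a (m + k)).val • V.g (m + k) ∈ V.sub (m + K)) :
    HasSum (fun n => (a n).val • V.g n) x := by
  rw [HasSum, SummationFilter.unconditional_filter, ← tendsto_sub_nhds_zero_iff,
    V.hasBasis_nhds_zero.tendsto_right_iff]
  intro n _
  obtain ⟨K, hK⟩ : ∃ K : ℕ, n ≤ m + K := ⟨(n - m).toNat, by omega⟩
  have hinj : Set.InjOn (fun k : ℕ => m + (k : ℤ)) (Finset.range K) := by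
    intro i _ j _ hij
    simpa using hij
  filter_upwards [eventually_ge_atTop ((Finset.range K).image fun k : ℕ => m + (k : ℤ))] with s hs
  rw [← Finset.sum_sdiff hs, Finset.sum_image hinj, add_sub_assoc]
  refine (V.sub n).add_mem (sum_mem fun i hi => ?_) ?_
  · rcases lt_or_ge i m with him | him
    · simp [ha i him]
    · refine (V.sub n).nsmul_mem (V.sub_anti ?_ (V.g_mem i)) _
      simp only [Finset.mem_sdiff, Finset.mem_image, Finset.mem_range, not_exists, not_and] at hi
      have := hi.2 (i - m).toNat
      omega
  · rw [← neg_sub]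
    exact (V.sub n).neg_mem (V.sub_anti hK (h K))

/-- Every element has an expansion. -/
theorem exists_isExpansion (x : G) : ∃ a, V.IsExpansion a x := by
  obtain ⟨m, hm⟩ := V.exists_mem_sub x
  have hd : ∀ (n : ℤ) (y : G), ∃ c : ZMod p, y ∈ V.sub n → y - c.val • V.g n ∈ V.sub (n + 1) := by
    intro n y
    by_cases hy : y ∈ V.sub n
    · obtain ⟨c, hc⟩ := V.exists_digit n hy
      exact ⟨c, fun _ => hc⟩
    · exact ⟨0, fun h => absurd h hy⟩
  choose d hd using hd
  let y : ℕ → G := fun k => Nat.rec x (fun k yk => yk - (d (m + k) yk).val • V.g (m + k)) k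
  have hy : ∀ k : ℕ, y k ∈ V.sub (m + k) := by
    intro k
    induction k with
    | zero => simpa [y] using hm
    | succ k ih =>
      have := hd _ _ ih
      rw [add_assoc] at this
      exact_mod_cast this
  let a : ℤ → ZMod p := fun n => if n < m then 0 else d n (y (n - m).toNat)
  have ha : ∀ k : ℕ, a (m + k) = d (m + k) (y k) := by
    intro k
    simp [a]
  refine ⟨a, ⟨m, fun n hn => by simp [a, hn]⟩, V.hasSum_of (m := m) (fun n hn => by simp [a, hn]) ?_⟩
  intro K
  have : x - ∑ k ∈ Finset.range K, (a (m + k)).val • V.g (m + k) = y K := by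
    induction K with
    | zero => simp [y]
    | succ K ih =>
      rw [Finset.sum_range_succ, ← sub_sub, ih, ha]
  rw [this]
  exact hy K

/-- Every sequence of digits vanishing far to the left is the expansion of some element. -/
theorem exists_hasSum {a : ℤ → ZMod p} (ha : ∃ m, ∀ n < m, a n = 0) :
    ∃ x, V.IsExpansion a x := by
  obtain ⟨m, hm⟩ := ha
  let S : ℕ → G := fun K => ∑ k ∈ Finset.range K, (a (m + k)).val • V.g (m + k)
  let t : ℕ → Set G := fun K => {x | x - S K ∈ V.sub (m + K)}
  have hcl : ∀ K, IsClosed (t K) := fun K =>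
    (V.isClosed_sub (m + K)).preimage (continuous_id.sub continuous_const)
  have hne : (⋂ K, t K).Nonempty := by
    refine IsCompact.nonempty_iInter_of_sequence_nonempty_isCompact_isClosed t ?_ ?_ ?_ hcl
    · intro K x hx
      have h1 : x - S (K + 1) ∈ V.sub (m + (K + 1 : ℕ)) := hx
      have h2 : S (K + 1) = S K + (a (m + K)).val • V.g (m + K) := Finset.sum_range_succ _ _
      have h3 : x - S K = (x - S (K + 1)) + (a (m + K)).val • V.g (m + K) := by
        rw [h2]; abel
      change x - S K ∈ V.sub (m + K)
      rw [h3]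
      exact (V.sub _).add_mem (V.sub_anti (by push_cast; omega) h1)
        ((V.sub _).nsmul_mem (V.g_mem _) _)
    · exact fun K => ⟨S K, by simp [t]⟩
    · have : t 0 = (V.sub m : Set G) := by ext x; simp [t, S]
      rw [this]
      exact V.isCompact_sub m
  obtain ⟨x, hx⟩ := hne
  rw [Set.mem_iInter] at hx
  exact ⟨x, ⟨m, hm⟩, V.hasSum_of hm hx⟩

theorem IsExpansion.mem_sub_iff {V : VilenkinStructure p G} {a : ℤ → ZMod p} {x : G}
    (h : V.IsExpansion a x) (k : ℤ) : x ∈ V.sub k ↔ ∀ n < k, a n = 0 := by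
  obtain ⟨⟨m, hm⟩, hs⟩ := h
  rw [HasSum, SummationFilter.unconditional_filter] at hs
  constructor
  · intro hx
    by_contra hne
    push Not at hne
    obtain ⟨n₀, ⟨hn₀k, hn₀⟩, hmin⟩ := Int.exists_least_of_bdd (P := fun n => n < k ∧ a n ≠ 0)
      ⟨m, fun z hz => by
        by_contra hlt
        exact hz.2 (hm z (by omega))⟩ hne
    have hlow : ∀ n < n₀, a n = 0 := by
      intro n hn
      by_contra hne'
      have := hmin n ⟨by omega, hne'⟩
      omega
    have hdiff : x - (a n₀).val • V.g n₀ ∈ V.sub (n₀ + 1) := by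
      refine (V.isClosed_sub (n₀ + 1)).mem_of_tendsto (hs.sub_const _) ?_
      filter_upwards [eventually_ge_atTop {n₀}] with s hs'
      have hmem : n₀ ∈ s := hs' (Finset.mem_singleton_self _)
      rw [← Finset.add_sum_erase _ _ hmem, add_sub_cancel_left]
      refine sum_mem fun i hi => ?_
      rcases lt_or_ge i n₀ with hlt | hge
      · simp [hlow i hlt]
      · have := Finset.ne_of_mem_erase hi
        exact (V.sub _).nsmul_mem (V.sub_anti (by omega) (V.g_mem i)) _
    have hterm : (a n₀).val • V.g n₀ ∈ V.sub (n₀ + 1) := by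
      have := (V.sub (n₀ + 1)).sub_mem (V.sub_anti (by omega : n₀ + 1 ≤ k) hx) hdiff
      simpa using this
    apply V.g_notMem n₀
    have hmul := (V.sub (n₀ + 1)).nsmul_mem hterm ((a n₀)⁻¹).val
    have h1 : ((a n₀)⁻¹).val • (a n₀).val • V.g n₀ = V.g n₀ := by
      have h2 : (((a n₀)⁻¹).val * (a n₀).val) % p = 1 := by
        rw [← ZMod.val_mul, inv_mul_cancel₀ hn₀, ZMod.val_one]
      rw [← mul_smul, ← Nat.mod_add_div (((a n₀)⁻¹).val * (a n₀).val) p, h2, add_smul, mul_comm p,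
        mul_smul, V.p_smul_g, smul_zero, add_zero, one_smul]
    rwa [h1] at hmul
  · intro ha
    exact (V.isClosed_sub k).mem_of_tendsto hs
      (Eventually.of_forall fun s => sum_mem fun i _ => V.term_mem ha)

theorem IsExpansion.add {V : VilenkinStructure p G} {a b : ℤ → ZMod p} {x y : G}
    (hx : V.IsExpansion a x) (hy : V.IsExpansion b y) : V.IsExpansion (a + b) (x + y) := by
  obtain ⟨⟨m, hm⟩, hs⟩ := hx
  obtain ⟨⟨l, hl⟩, ht⟩ := hy
  refine ⟨⟨min m l, fun n hn => ?_⟩, ?_⟩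
  · simp [hm n (lt_of_lt_of_le hn (min_le_left _ _)), hl n (lt_of_lt_of_le hn (min_le_right _ _))]
  · convert hs.add ht using 2 with n
    rw [← add_smul, Pi.add_apply, ZMod.val_add]
    conv_rhs => rw [← Nat.mod_add_div ((a n).val + (b n).val) p, add_smul, mul_comm p, mul_smul,
      V.p_smul_g, smul_zero, add_zero]

theorem IsExpansion.unique {V : VilenkinStructure p G} {a b : ℤ → ZMod p} {x : G}
    (ha : V.IsExpansion a x) (hb : V.IsExpansion b x) : a = b := by
  have hb' : ∃ m, ∀ n < m, (-b) n = 0 := by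
    obtain ⟨m, hm⟩ := hb.1
    exact ⟨m, fun n hn => by simp [hm n hn]⟩
  obtain ⟨y, hy⟩ := V.exists_hasSum hb'
  have hmem : ∀ {c : ℤ → ZMod p} {z : G}, V.IsExpansion c z → z = 0 → c = 0 := by
    rintro c z hc rfl
    funext n
    exact (hc.mem_sub_iff (n + 1)).1 (zero_mem _) n (by omega)
  have hz : x + y = 0 := by
    refine V.eq_zero_of_forall_mem _ fun k => ?_
    rw [(hb.add hy).mem_sub_iff]
    simp
  have := hmem (ha.add hy) hz
  simpa [sub_eq_zero, ← sub_eq_add_neg] using this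

/-- The sequence of digits of `x`. -/
noncomputable def digits (x : G) : ℤ → ZMod p := Classical.choose (V.exists_isExpansion x)

theorem isExpansion_digits (x : G) : V.IsExpansion (V.digits x) x :=
  Classical.choose_spec (V.exists_isExpansion x)

theorem IsExpansion.digits_eq {V : VilenkinStructure p G} {a : ℤ → ZMod p} {x : G}
    (h : V.IsExpansion a x) : V.digits x = a :=
  (V.isExpansion_digits x).unique h

theorem digits_add (x y : G) : V.digits (x + y) = V.digits x + V.digits y :=
  ((V.isExpansion_digits x).add (V.isExpansion_digits y)).digits_eq

theorem mem_sub_iff_digits (x : G) (k : ℤ) : x ∈ V.sub k ↔ ∀ n < k, V.digits x n = 0 :=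
  (V.isExpansion_digits x).mem_sub_iff k

theorem eq_of_digits_eq {x y : G} (h : V.digits x = V.digits y) : x = y := by
  have := V.t2Space
  have hx := (V.isExpansion_digits x).2
  rw [h] at hx
  exact hx.unique (V.isExpansion_digits y).2

/-- The `j`-th power `𝒜^j : ∑ₙ aₙ gₙ ↦ ∑ₙ aₙ g_{n-j}` of the dilation operator
`𝒜 : ∑ₙ aₙ gₙ ↦ ∑ₙ aₙ g_{n-1}`, as a function. -/
noncomputable def shift (j : ℤ) (x : G) : G := ∑' n, (V.digits x n).val • V.g (n - j)

theorem isExpansion_shift (j : ℤ) (x : G) :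
    V.IsExpansion (fun n => V.digits x (n + j)) (V.shift j x) := by
  have := V.t2Space
  have hb : ∃ m, ∀ n < m, V.digits x (n + j) = 0 := by
    obtain ⟨m, hm⟩ := (V.isExpansion_digits x).1
    exact ⟨m - j, fun n hn => hm _ (by omega)⟩
  obtain ⟨y, hy⟩ := V.exists_hasSum hb
  have h1 : HasSum (fun n => (V.digits x n).val • V.g (n - j)) y := by
    rw [← (Equiv.addRight j).hasSum_iff]
    simpa [Function.comp_def] using hy.2
  rwa [shift, h1.tsum_eq]

theorem digits_shift (j : ℤ) (x : G) (n : ℤ) : V.digits (V.shift j x) n = V.digits x (n + j) :=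
  congrFun (V.isExpansion_shift j x).digits_eq n

/-- The `j`-th power `𝒜^j` of the dilation operator `𝒜`, as an automorphism of `G`. -/
noncomputable def dilation (j : ℤ) : G ≃+ G where
  toFun x := V.shift j x
  invFun x := V.shift (-j) x
  left_inv x := V.eq_of_digits_eq (by funext n; simp [digits_shift])
  right_inv x := V.eq_of_digits_eq (by funext n; simp [digits_shift])
  map_add' x y := V.eq_of_digits_eq (by funext n; simp [digits_shift, digits_add])

theorem digits_dilation (j : ℤ) (x : G) (n : ℤ) :
    V.digits (V.dilation j x) n = V.digits x (n + j) :=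
  V.digits_shift j x n

/-- The automorphisms `dilation j` are the powers of `dilation 1`. -/
theorem dilation_add (i j : ℤ) (x : G) :
    V.dilation (i + j) x = V.dilation i (V.dilation j x) :=
  V.eq_of_digits_eq (by funext n; simp [digits_dilation, add_assoc])

theorem dilation_zero (x : G) : V.dilation 0 x = x :=
  V.eq_of_digits_eq (by funext n; simp [digits_dilation])

theorem continuous_dilation (j : ℤ) : Continuous (V.dilation j) := by
  refine continuous_of_continuousAt_zero (V.dilation j) ?_
  rw [ContinuousAt, map_zero, V.hasBasis_nhds_zero.tendsto_right_iff]
  intro n _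
  filter_upwards [V.hasBasis_nhds_zero.mem_of_mem (i := n + j) trivial] with x hx
  rw [SetLike.mem_coe, mem_sub_iff_digits] at hx ⊢
  intro k hk
  rw [digits_dilation]
  exact hx _ (by omega)

end Expansion

section Characters

variable {p : ℕ} [Fact p.Prime] {G : Type*} [AddCommGroup G] [TopologicalSpace G]
  [IsTopologicalAddGroup G] (V : VilenkinStructure p G)

/-- The group `X` of continuous characters of `G`, with the usual (compact-open) topology. -/
abbrev Characters (G : Type*) [AddCommGroup G] [TopologicalSpace G] : Type _ :=
  PontryaginDual (Multiplicative G)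

/-- The value `(χ, x)` of the character `χ` at `x`. -/
noncomputable def pairing (χ : Characters G) (x : G) : ℂ := (χ (Multiplicative.ofAdd x) : ℂ)

/-- The annihilator `G_n^⊥` of `G_n`. -/
def annihilator (n : ℤ) : Subgroup (Characters G) where
  carrier := {χ | ∀ x ∈ V.sub n, pairing χ x = 1}
  one_mem' := fun x _ => by simp [pairing]
  mul_mem' := by
    intro χ ψ hχ hψ x hx
    have h : pairing (χ * ψ) x = pairing χ x * pairing ψ x := Circle.coe_mul _ _
    rw [h, hχ x hx, hψ x hx, one_mul]
  inv_mem' := by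
    intro χ hχ x hx
    have h : pairing χ⁻¹ x = (pairing χ x)⁻¹ := Circle.coe_inv _
    rw [h, hχ x hx, inv_one]

/-- The character `χ𝒜^j`, given by `(χ𝒜^j, x) = (χ, 𝒜^j x)`. -/
noncomputable def charDilation (j : ℤ) (χ : Characters G) : Characters G :=
  PontryaginDual.map
    ⟨AddMonoidHom.toMultiplicative (V.dilation j : G →+ G),
      V.continuous_dilation j⟩ χ

/-- The Rademacher function `r_n`, given by `(r_n, ∑ₖ aₖ gₖ) = exp(2πi aₙ / p)`. -/
noncomputable def rademacher (n : ℤ) : Characters G :=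
  let f : Multiplicative G →* Circle :=
    { toFun := fun x => ZMod.toCircle (V.digits x.toAdd n)
      map_one' := by
        have h : V.digits (0 : G) = 0 := by simpa using V.digits_add 0 0
        simp [h]
      map_mul' := fun x y => by simp [digits_add, AddChar.map_add_eq_mul] }
  ⟨f, by
    refine continuous_of_continuousAt_one f ?_
    rw [ContinuousAt, map_one]
    refine tendsto_const_nhds.congr' ?_
    have h : ∀ᶠ x in 𝓝 (0 : G), x ∈ V.sub (n + 1) :=
      V.hasBasis_nhds_zero.mem_of_mem (i := n + 1) trivial
    have h' : ∀ᶠ x in 𝓝 (1 : Multiplicative G), x.toAdd ∈ V.sub (n + 1) := h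
    filter_upwards [h'] with x hx
    have := (V.mem_sub_iff_digits _ _).1 hx n (by omega)
    simp [f, this]⟩

end Characters

section Fourier

variable {p : ℕ} {G : Type*} [AddCommGroup G] [TopologicalSpace G]
  [MeasurableSpace G] [MeasurableSpace (Characters G)]
  (V : VilenkinStructure p G) (μ : Measure G) (ν : Measure (Characters G))

/-- `F ∈ L₂(X)` is the Fourier transform of `f ∈ L₂(G)`: the functions
`χ ↦ ∫_{G_{-n}} f(x) conj (χ, x) dμ(x)` converge to `F` in the norm of `L₂(X)` as `n → ∞`. -/
def IsFourierTransform (f : G → ℂ) (F : Characters G → ℂ) : Prop :=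
  MemLp f 2 μ ∧ MemLp F 2 ν ∧
    Tendsto (fun n : ℕ => eLpNorm
      (fun χ => (∫ x in (V.sub (-n) : Set G), f x * conj (pairing χ x) ∂μ) - F χ) 2 ν)
      atTop (𝓝 0)

/-- The class `𝔇_M(G_{-N})` of step functions supported in `G_{-N}` and constant on the cosets
of `G_M`, as a set of elements of `L₂(G)`. -/
def stepFunctions (M N : ℤ) : Set (Lp ℂ 2 μ) :=
  {φ | ∃ f : G → ℂ, φ =ᵐ[μ] f ∧ (∀ x, x ∉ V.sub (-N) → f x = 0) ∧
    ∀ x, ∀ y ∈ V.sub M, f (x + y) = f x}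

end Fourier

section MRA

variable {p : ℕ} [Fact p.Prime] {G : Type*} [AddCommGroup G] [TopologicalSpace G]
  [IsTopologicalAddGroup G] [MeasurableSpace G] (V : VilenkinStructure p G) (μ : Measure G)

/-- The set `H₀` of all `a_{-1} g_{-1} + ⋯ + a_{-s} g_{-s}`, `a_j ∈ {0, …, p - 1}`. -/
def H₀ : Set G :=
  {h | ∃ (s : ℕ) (a : Fin s → Fin p), h = ∑ j, (a j : ℕ) • V.g (-((j : ℕ) + 1 : ℤ))}

/-- The function `f` is square integrable and its class belongs to `W ⊆ L₂(G)`. -/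
def MemSubspace (W : Submodule ℂ (Lp ℂ 2 μ)) (f : G → ℂ) : Prop :=
  ∃ hf : MemLp f 2 μ, hf.toLp f ∈ W

/-- The shifts `(φ(x - h))_{h ∈ H₀}` form an orthonormal basis of `W`. -/
def IsScalingFunction (W : Submodule ℂ (Lp ℂ 2 μ)) (φ : Lp ℂ 2 μ) : Prop :=
  ∃ e : V.H₀ → Lp ℂ 2 μ, (∀ h, e h =ᵐ[μ] fun x => φ (x - h)) ∧ Orthonormal ℂ e ∧
    (Submodule.span ℂ (Set.range e)).topologicalClosure = W

/-- A family `(W_n)` of closed subspaces is a multiresolution analysis of `L₂(G)`. -/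
structure IsMRA (W : ℤ → Submodule ℂ (Lp ℂ 2 μ)) : Prop where
  isClosed : ∀ n, IsClosed (W n : Set (Lp ℂ 2 μ))
  le_succ : ∀ n, W n ≤ W (n + 1)
  dense_iUnion : Dense (⋃ n, (W n : Set (Lp ℂ 2 μ)))
  iInf_eq_bot : ⨅ n, W n = ⊥
  dilation_iff : ∀ (n : ℤ) (f : G → ℂ),
    MemSubspace μ (W n) f ↔ MemSubspace μ (W (n + 1)) (fun x => f (V.dilation 1 x))
  shift_mem : ∀ f : G → ℂ, MemSubspace μ (W 0) f →
    ∀ h ∈ V.H₀, MemSubspace μ (W 0) (fun x => f (x - h))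
  exists_scaling : ∃ φ, V.IsScalingFunction μ (W 0) φ

/-- The closed linear span `V_j` of the functions `φ(𝒜^j x - h)`, `h ∈ H₀`, in `L₂(G)`. -/
noncomputable def generatedSpace (φ : Lp ℂ 2 μ) (j : ℤ) : Submodule ℂ (Lp ℂ 2 μ) :=
  (Submodule.span ℂ
    {F : Lp ℂ 2 μ | ∃ h ∈ V.H₀, F =ᵐ[μ] fun x => φ (V.dilation j x - h)}).topologicalClosure

/-- `φ` generates an orthogonal MRA: its shifts are orthonormal, and the spaces `V_j` spanned by
the dilated shifts of `φ` form a multiresolution analysis with scaling function `φ`. -/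
def GeneratesOrthogonalMRA (φ : Lp ℂ 2 μ) : Prop :=
  V.IsScalingFunction μ (V.generatedSpace μ φ 0) φ ∧ V.IsMRA μ (V.generatedSpace μ φ)

end MRA

end VilenkinStructure

/-! Addition in `G` is digitwise addition modulo p without carries, so each quotient G_m / G_{m+n}
and its dual G_{m+n}^⊥ / G_m^⊥ is a copy of (ZMod p)^n, with representatives `combo` and `rad`. The
Fourier analysis needed here reduces to character sums over these finite groups.

The product Φ inherits invariance under G_{-N}^⊥ from the mask. It vanishes off G_M^⊥, because a
suitable dilation carries any character outside G_M^⊥ into the one shell where the mask product is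
zero (`maskProduct_eq_zero`). So Φ is a step function with finitely many values, and its inverse
transform is the finite sum `inverseTransform`, supported in G_{-N} and constant on cosets of G_M.
Uniqueness (`IsFourierTransform.ae_eq`) holds because the integral of a function over any coset is
recovered from its truncated transforms, and the integrals over all cosets determine an L₂ function.

The MRA axioms then come from four facts about this explicit φ. Orthonormality: the inner product of
two shifts is a sum of |Φ|² against a character at some δ in H₀; as δ has no digits of index ≥ 0,
the sum over the exponents of r_0, …, r_{M-1} collapses to 1 by hypothesis and an orthogonality sum
remains (`integral_inverseTransform_translate`). Nesting: (T1) and (T2) make the mask a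
trigonometric polynomial, so Φ(χ) = m₀(χ) Φ(χ𝒜^{-1}) is the transform of a finite refinement
equation (`exists_refinement`), which puts φ in V_1. Density: Φ(1) = 1 and the orthonormality
condition force Φ to vanish at the other r_0^{α_0} ⋯ r_{M-1}^{α_{M-1}}, so p^N shifts of φ sum to
the indicator of G_{-N}; dilating and translating gives the indicator of every coset
(`dense_iUnion_generatedSpace`). Trivial intersection: elements of V_n are invariant under G_{M+n},
so an element of all V_n is invariant under every translation, hence zero in L₂ because `G` has
infinite measure (`iInf_generatedSpace`). -/

namespace VilenkinStructure

/-! ### Digits as coordinates: finite quotients and the set H₀ -/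

section Digits

variable {p : ℕ} [Fact p.Prime] {G : Type*} [AddCommGroup G] [TopologicalSpace G]
  [IsTopologicalAddGroup G] (V : VilenkinStructure p G)

/-- The digits of an element, as an additive homomorphism. -/
noncomputable def digitsHom : G →+ (ℤ → ZMod p) where
  toFun := V.digits
  map_zero' := by simpa using V.digits_add 0 0
  map_add' := V.digits_add

theorem digits_zero : V.digits (0 : G) = 0 := V.digitsHom.map_zero

theorem digits_sub (x y : G) : V.digits (x - y) = V.digits x - V.digits y := V.digitsHom.map_sub x y

theorem digits_nsmul (n : ℕ) (x : G) : V.digits (n • x) = n • V.digits x := V.digitsHom.map_nsmul n x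

theorem digits_sum {ι : Type*} (s : Finset ι) (f : ι → G) (n : ℤ) :
    V.digits (∑ i ∈ s, f i) n = ∑ i ∈ s, V.digits (f i) n := by
  have := map_sum V.digitsHom f s
  exact (congrFun this n).trans (Finset.sum_apply _ _ _)

theorem digits_val_nsmul_g (c : ZMod p) (n : ℤ) :
    V.digits (c.val • V.g n) = Pi.single n c := by
  refine IsExpansion.digits_eq ⟨⟨n, fun k hk => by simp [hk.ne]⟩, ?_⟩
  have := hasSum_single (f := fun k => ((Pi.single n c : ℤ → ZMod p) k).val • V.g k) n
    (fun k hk => by simp [hk])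
  simpa using this

theorem prime_nsmul_eq_zero (V : VilenkinStructure p G) (x : G) : p • x = 0 :=
  V.eq_of_digits_eq (by funext n; simp [digits_nsmul, digits_zero])

/-- The element `∑_{j < n} a_j g_{m + j}`. -/
noncomputable def combo (m : ℤ) (n : ℕ) (a : Fin n → ZMod p) : G :=
  ∑ j, (a j).val • V.g (m + (j : ℕ))

theorem digits_combo (m : ℤ) (n : ℕ) (a : Fin n → ZMod p) (j : Fin n) :
    V.digits (V.combo m n a) (m + (j : ℕ)) = a j := by
  rw [combo, digits_sum, Finset.sum_eq_single j]
  · simp [digits_val_nsmul_g]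
  · intro i _ hi
    rw [digits_val_nsmul_g, Pi.single_eq_of_ne]
    intro h
    exact hi (Fin.ext (by omega))
  · simp

theorem digits_combo_of_lt {m : ℤ} (n : ℕ) (a : Fin n → ZMod p) {k : ℤ} (h : k < m) :
    V.digits (V.combo m n a) k = 0 := by
  rw [combo, digits_sum]
  refine Finset.sum_eq_zero fun i _ => ?_
  rw [digits_val_nsmul_g, Pi.single_eq_of_ne]
  omega

theorem digits_combo_of_ge {m : ℤ} {n : ℕ} (a : Fin n → ZMod p) {k : ℤ} (h : m + n ≤ k) :
    V.digits (V.combo m n a) k = 0 := by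
  rw [combo, digits_sum]
  refine Finset.sum_eq_zero fun i _ => ?_
  rw [digits_val_nsmul_g, Pi.single_eq_of_ne]
  omega

theorem combo_mem (m : ℤ) (n : ℕ) (a : Fin n → ZMod p) : V.combo m n a ∈ V.sub m := by
  rw [mem_sub_iff_digits]
  exact fun k hk => V.digits_combo_of_lt n a hk

/-- The digits with index in [m, m + n) name the coset, which makes the elements `combo m n a` a
complete set of representatives of G_m / G_{m+n}, without repetition. -/
theorem sub_combo_mem_iff {m : ℤ} {n : ℕ} {a : Fin n → ZMod p} {x : G} (hx : x ∈ V.sub m) :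
    x - V.combo m n a ∈ V.sub (m + n) ↔ (fun j : Fin n => V.digits x (m + (j : ℕ))) = a := by
  rw [mem_sub_iff_digits] at hx ⊢
  constructor
  · intro h
    funext j
    have := h (m + (j : ℕ)) (by omega)
    rwa [digits_sub, Pi.sub_apply, digits_combo, sub_eq_zero] at this
  · rintro rfl k hk
    rw [digits_sub, Pi.sub_apply]
    rcases lt_or_ge k m with h | h
    · rw [hx k h, digits_combo_of_lt _ _ _ h, sub_zero]
    · obtain ⟨j, rfl⟩ := Int.le.dest h
      have := V.digits_combo m n (fun j : Fin n => V.digits x (m + (j : ℕ))) ⟨j, by omega⟩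
      simp only at this
      rw [this, sub_self]

/-- In this form H₀ is visibly a subgroup, which its definition by digit sums hides. -/
theorem mem_H₀_iff {h : G} : h ∈ V.H₀ ↔ ∀ n, 0 ≤ n → V.digits h n = 0 := by
  constructor
  · rintro ⟨s, a, rfl⟩ n hn
    rw [digits_sum]
    refine Finset.sum_eq_zero fun i _ => ?_
    have := V.digits_val_nsmul_g ((a i : ℕ) : ZMod p) (-((i : ℕ) + 1 : ℤ))
    rw [ZMod.val_natCast_of_lt (a i).2] at this
    rw [this, Pi.single_eq_of_ne]
    omega
  · intro hh
    obtain ⟨m, hm⟩ := V.exists_mem_sub h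
    have hm := (V.mem_sub_iff_digits _ _).1 hm
    refine ⟨(-m).toNat, fun j => ⟨(V.digits h (-((j : ℕ) + 1 : ℤ))).val, ZMod.val_lt _⟩, ?_⟩
    refine V.eq_of_digits_eq (funext fun k => ?_)
    rw [digits_sum]
    simp only [digits_val_nsmul_g]
    by_cases hk : k < 0 ∧ m ≤ k
    · rw [Finset.sum_eq_single ⟨(-k - 1).toNat, by omega⟩]
      · rw [show -(((⟨(-k - 1).toNat, by omega⟩ : Fin (-m).toNat) : ℕ) + 1 : ℤ) = k by
          simp only; omega]
        simp
      · intro i _ hi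
        rw [Pi.single_eq_of_ne]
        rintro rfl
        exact hi (Fin.ext (by simp only; omega))
      · simp
    · rw [Finset.sum_eq_zero]
      · by_cases h0 : 0 ≤ k
        · exact hh k h0
        · exact hm k (by omega)
      · intro i _
        rw [Pi.single_eq_of_ne]
        omega

theorem dilation_mem_iff (j k : ℤ) (x : G) : V.dilation j x ∈ V.sub k ↔ x ∈ V.sub (k + j) := by
  simp only [mem_sub_iff_digits, digits_dilation]
  exact ⟨fun h n hn => by simpa using h (n - j) (by omega), fun h n hn => h _ (by omega)⟩

end Digits

/-! ### Character sums over (ZMod p)^n -/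

section FiniteOrthogonality

variable {p : ℕ} [Fact p.Prime]

theorem map_sum_stdAddChar {ι : Type*} [Fintype ι] (f : ι → ZMod p) :
    (ZMod.stdAddChar (∑ j, f j) : ℂ) = ∏ j, (ZMod.stdAddChar (f j) : ℂ) := by
  have := map_prod (ZMod.stdAddChar (N := p)).toMonoidHom (fun j => Multiplicative.ofAdd (f j))
    Finset.univ
  rwa [← ofAdd_sum] at this

theorem sum_stdAddChar_dot {ι : Type*} [Fintype ι] [DecidableEq ι] (b : ι → ZMod p) :
    ∑ a : ι → ZMod p, (ZMod.stdAddChar (∑ j, a j * b j) : ℂ) =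
      if b = 0 then (p : ℂ) ^ Fintype.card ι else 0 := by
  have h1 : ∀ a : ι → ZMod p, (ZMod.stdAddChar (∑ j, a j * b j) : ℂ) =
      ∏ j, (ZMod.stdAddChar (a j * b j) : ℂ) := fun a => by
    exact map_sum_stdAddChar _
  simp_rw [h1]
  rw [← Fintype.prod_sum fun (j : ι) (c : ZMod p) => (ZMod.stdAddChar (c * b j) : ℂ)]
  simp_rw [AddChar.sum_mulShift _ (ZMod.isPrimitive_stdAddChar p)]
  split_ifs with h
  · simp [h, ZMod.card]
  · obtain ⟨j, hj⟩ := Function.ne_iff.1 h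
    exact Finset.prod_eq_zero (Finset.mem_univ j) (by simp [show b j ≠ 0 from hj])

end FiniteOrthogonality

/-! ### Algebra of the pairing between characters and points -/

section Pairing

variable {G : Type*} [AddCommGroup G] [TopologicalSpace G]

theorem pairing_mul (χ ψ : Characters G) (x : G) :
    pairing (χ * ψ) x = pairing χ x * pairing ψ x := Circle.coe_mul _ _

theorem pairing_one (x : G) : pairing (1 : Characters G) x = 1 := rfl

theorem pairing_inv (χ : Characters G) (x : G) : pairing χ⁻¹ x = (pairing χ x)⁻¹ :=
  Circle.coe_inv _

theorem pairing_pow (χ : Characters G) (n : ℕ) (x : G) : pairing (χ ^ n) x = pairing χ x ^ n := by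
  induction n with
  | zero => simp [pairing_one]
  | succ n ih => rw [pow_succ, pairing_mul, ih, pow_succ]

theorem pairing_prod {ι : Type*} (s : Finset ι) (f : ι → Characters G) (x : G) :
    pairing (∏ i ∈ s, f i) x = ∏ i ∈ s, pairing (f i) x := by
  classical
  induction s using Finset.induction_on with
  | empty => simp [pairing_one]
  | insert i s hi ih => rw [Finset.prod_insert hi, Finset.prod_insert hi, pairing_mul, ih]

theorem pairing_add (χ : Characters G) (x y : G) :
    pairing χ (x + y) = pairing χ x * pairing χ y := by
  simp [pairing, ofAdd_add, map_mul]

theorem pairing_zero (χ : Characters G) : pairing χ 0 = 1 := by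
  simp [pairing]

theorem pairing_neg (χ : Characters G) (x : G) : pairing χ (-x) = (pairing χ x)⁻¹ := by
  simp [pairing, ofAdd_neg, map_inv]

theorem pairing_sub (χ : Characters G) (x y : G) :
    pairing χ (x - y) = pairing χ x * (pairing χ y)⁻¹ := by
  rw [sub_eq_add_neg, pairing_add, pairing_neg]

theorem pairing_nsmul (χ : Characters G) (n : ℕ) (x : G) :
    pairing χ (n • x) = pairing χ x ^ n := by
  simp [pairing, ofAdd_nsmul, map_pow]

theorem norm_pairing (χ : Characters G) (x : G) : ‖pairing χ x‖ = 1 := Circle.norm_coe _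

theorem pairing_ne_zero (χ : Characters G) (x : G) : pairing χ x ≠ 0 := Circle.coe_ne_zero _

theorem conj_pairing (χ : Characters G) (x : G) : conj (pairing χ x) = (pairing χ x)⁻¹ := by
  rw [pairing, ← Circle.coe_inv_eq_conj, Circle.coe_inv]

theorem continuous_pairing (χ : Characters G) : Continuous (pairing χ) :=
  continuous_subtype_val.comp ((map_continuous χ).comp continuous_ofAdd)

theorem characters_ext {χ ψ : Characters G} (h : ∀ x, pairing χ x = pairing ψ x) : χ = ψ :=
  PontryaginDual.ext fun a => Circle.coe_injective (h a.toAdd)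

end Pairing

/-! ### Annihilators and Rademacher products -/

section Annihilator

variable {p : ℕ} [Fact p.Prime] {G : Type*} [AddCommGroup G] [TopologicalSpace G]
  [IsTopologicalAddGroup G] (V : VilenkinStructure p G)

theorem mem_annihilator {n : ℤ} {χ : Characters G} :
    χ ∈ V.annihilator n ↔ ∀ x ∈ V.sub n, pairing χ x = 1 := Iff.rfl

theorem annihilator_mono {m n : ℤ} (h : m ≤ n) : V.annihilator m ≤ V.annihilator n :=
  fun _ hχ x hx => hχ x (V.sub_anti h hx)

theorem pairing_pow_eq_one (V : VilenkinStructure p G) (χ : Characters G) (x : G) : pairing χ x ^ p = 1 := by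
  rw [← pairing_nsmul, V.prime_nsmul_eq_zero, pairing_zero]

theorem exists_pairing_eq (V : VilenkinStructure p G) (χ : Characters G) (x : G) :
    ∃ c : ZMod p, pairing χ x = ZMod.stdAddChar c := by
  have hp : p ≠ 0 := (Fact.out : p.Prime).ne_zero
  obtain ⟨i, hi, h⟩ := (Complex.isPrimitiveRoot_exp p hp).eq_pow_of_pow_eq_one
    (V.pairing_pow_eq_one χ x)
  refine ⟨(i : ZMod p), ?_⟩
  have := ZMod.stdAddChar_coe (N := p) i
  rw [Int.cast_natCast] at this
  rw [← h, ← Complex.exp_nat_mul]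
  refine Eq.trans ?_ this.symm
  congr 1
  push_cast
  ring

/-- A neighbourhood of `1` in the circle containing no nontrivial `p`-th root of unity. -/
def rootFreeNhd (p : ℕ) : Set Circle := {z | z ^ p = 1 ∧ z ≠ 1}ᶜ

theorem isOpen_rootFreeNhd : IsOpen (rootFreeNhd p) := by
  have hp : 0 < p := (Fact.out : p.Prime).pos
  refine (Set.Finite.isClosed ?_).isOpen_compl
  have h : ((Polynomial.nthRoots p (1 : ℂ)).toFinset : Set ℂ).Finite := Finset.finite_toSet _
  refine (h.preimage (f := fun z : Circle => (z : ℂ)) Circle.coe_injective.injOn).subset ?_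
  rintro z ⟨hz, -⟩
  simp only [Set.mem_preimage, Finset.mem_coe, Multiset.mem_toFinset, Polynomial.mem_nthRoots hp]
  rw [← Circle.coe_pow, hz, Circle.coe_one]

theorem mem_rootFreeNhd_iff (V : VilenkinStructure p G) (χ : Characters G) (x : G) :
    χ (Multiplicative.ofAdd x) ∈ rootFreeNhd p ↔ pairing χ x = 1 := by
  have h : χ (Multiplicative.ofAdd x) ^ p = 1 := by
    apply Circle.coe_injective
    rw [Circle.coe_pow, Circle.coe_one]
    exact V.pairing_pow_eq_one χ x
  have h2 : pairing χ x = 1 ↔ χ (Multiplicative.ofAdd x) = 1 := Circle.coe_eq_one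
  rw [h2]
  simp [rootFreeNhd, h]

/-- Values of χ are p-th roots of unity, so where χ stays in a neighbourhood of 1 free of nontrivial
roots it equals 1; by continuity this happens on some G_n. -/
theorem exists_mem_annihilator (χ : Characters G) : ∃ n, χ ∈ V.annihilator n := by
  have h : Continuous fun x : G => χ (Multiplicative.ofAdd x) :=
    (map_continuous χ).comp continuous_ofAdd
  have h0 : (0 : G) ∈ (fun x : G => χ (Multiplicative.ofAdd x)) ⁻¹' rootFreeNhd p :=
    (V.mem_rootFreeNhd_iff χ 0).2 (pairing_zero χ)
  obtain ⟨n, -, hn⟩ := V.hasBasis_nhds_zero.mem_iff.1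
    ((isOpen_rootFreeNhd.preimage h).mem_nhds h0)
  exact ⟨n, fun x hx => (V.mem_rootFreeNhd_iff χ x).1 (hn hx)⟩

/-- The annihilator is itself a subbasic set of the compact-open topology: the characters mapping
the compact set G_n into the root-free neighbourhood. -/
theorem isOpen_annihilator (n : ℤ) : IsOpen (V.annihilator n : Set (Characters G)) := by
  have hK : IsCompact (Multiplicative.ofAdd '' (V.sub n : Set G)) :=
    (V.isCompact_sub n).image continuous_ofAdd
  have h := (ContinuousMap.isOpen_setOfPred_mapsTo hK (isOpen_rootFreeNhd (p := p))).preimage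
    (ContinuousMonoidHom.isInducing_toContinuousMap (Multiplicative G) Circle).continuous
  have hs : (V.annihilator n : Set (Characters G)) =
      {χ : Characters G | Set.MapsTo χ (Multiplicative.ofAdd '' (V.sub n : Set G)) (rootFreeNhd p)} := by
    ext χ
    constructor
    · rintro hχ _ ⟨x, hx, rfl⟩
      exact (V.mem_rootFreeNhd_iff χ x).2 (hχ x hx)
    · intro hχ x hx
      exact (V.mem_rootFreeNhd_iff χ x).1 (hχ ⟨x, hx, rfl⟩)
  rw [hs]
  exact h

theorem pairing_rademacher (n : ℤ) (x : G) :
    pairing (V.rademacher n) x = ZMod.stdAddChar (V.digits x n) := rfl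

/-- The character `∏_{j < n} r_{m + j} ^ a_j`. -/
noncomputable def rad (m : ℤ) (n : ℕ) (a : Fin n → ZMod p) : Characters G :=
  ∏ j : Fin n, V.rademacher (m + (j : ℕ)) ^ (a j).val

theorem pairing_rad (m : ℤ) (n : ℕ) (a : Fin n → ZMod p) (x : G) :
    pairing (V.rad m n a) x = ZMod.stdAddChar (∑ j, a j * V.digits x (m + (j : ℕ))) := by
  rw [rad, pairing_prod, map_sum_stdAddChar]
  refine Finset.prod_congr rfl fun j _ => ?_
  rw [pairing_pow, pairing_rademacher, ← AddChar.map_nsmul_eq_pow, nsmul_eq_mul, ZMod.natCast_zmod_val]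

theorem rad_zero (m : ℤ) (n : ℕ) : V.rad m n 0 = 1 := by simp [rad]

theorem rad_mem_annihilator (m : ℤ) (n : ℕ) (a : Fin n → ZMod p) :
    V.rad m n a ∈ V.annihilator (m + n) := by
  intro x hx
  rw [mem_sub_iff_digits] at hx
  rw [pairing_rad, Finset.sum_eq_zero, AddChar.map_zero_eq_one]
  intro j _
  rw [hx _ (by omega), mul_zero]

theorem pairing_rad_g (m : ℤ) (n : ℕ) (a : Fin n → ZMod p) (j : Fin n) :
    pairing (V.rad m n a) (V.g (m + (j : ℕ))) = ZMod.stdAddChar (a j) := by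
  have h : V.digits (V.g (m + (j : ℕ))) = Pi.single (m + (j : ℕ)) 1 := by
    have : Fact (1 < p) := ⟨(Fact.out : p.Prime).one_lt⟩
    simpa [ZMod.val_one] using V.digits_val_nsmul_g (1 : ZMod p) (m + (j : ℕ))
  rw [pairing_rad, h, Finset.sum_eq_single j]
  · simp
  · intro i _ hi
    rw [Pi.single_eq_of_ne, mul_zero]
    intro h
    exact hi (Fin.ext (by omega))
  · simp

/-- The exponents are read off from the values of χ at g_m, …, g_{m+n-1}. The quotient character is
then trivial on these elements and on G_{m+n}, which together generate G_m. With
`rad_mul_inv_rad_mem`, the `rad m n a` represent G_{m+n}^⊥ / G_m^⊥ exactly once each. -/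
theorem exists_mul_inv_rad_mem {m : ℤ} {n : ℕ} {χ : Characters G}
    (hχ : χ ∈ V.annihilator (m + n)) : ∃ a, χ * (V.rad m n a)⁻¹ ∈ V.annihilator m := by
  choose c hc using V.exists_pairing_eq χ
  refine ⟨fun j => c (V.g (m + (j : ℕ))), fun x hx => ?_⟩
  set ψ := χ * (V.rad m n fun j => c (V.g (m + (j : ℕ))))⁻¹ with hψ
  have h1 : ∀ j : Fin n, pairing ψ (V.g (m + (j : ℕ))) = 1 := by
    intro j
    rw [hψ, pairing_mul, pairing_inv, pairing_rad_g, ← hc, mul_inv_cancel₀ (pairing_ne_zero _ _)]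
  have h2 : ψ ∈ V.annihilator (m + n) :=
    mul_mem hχ (inv_mem (V.rad_mem_annihilator _ _ _))
  have h3 := h2 _ ((V.sub_combo_mem_iff (n := n) hx).2 rfl)
  have h4 : ∀ a : Fin n → ZMod p, pairing ψ (V.combo m n a) = 1 := by
    intro a
    -- Written additively, the multiplicativity of ψ sends the sum defining `combo` to a sum of
    -- zeros.
    let f : G →+ Additive ℂ :=
      { toFun := fun x => Additive.ofMul (pairing ψ x)
        map_zero' := congrArg Additive.ofMul (pairing_zero ψ)
        map_add' := fun x y => congrArg Additive.ofMul (pairing_add ψ x y) }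
    have h5 : f (V.combo m n a) = 0 := by
      rw [combo, map_sum]
      refine Finset.sum_eq_zero fun j _ => ?_
      rw [map_nsmul, show f (V.g (m + (j : ℕ))) = 0 from congrArg Additive.ofMul (h1 j), smul_zero]
    exact congrArg Additive.toMul h5
  rw [pairing_sub, h4, inv_one, mul_one] at h3
  exact h3

theorem rad_mul_inv_rad_mem {m : ℤ} {n : ℕ} {a b : Fin n → ZMod p}
    (h : V.rad m n a * (V.rad m n b)⁻¹ ∈ V.annihilator m) : a = b := by
  funext j
  have := h (V.g (m + (j : ℕ))) (V.sub_anti (by omega) (V.g_mem _))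
  rw [pairing_mul, pairing_inv, pairing_rad_g, pairing_rad_g,
    mul_inv_eq_one₀ (by rw [ZMod.stdAddChar_apply]; exact Circle.coe_ne_zero _)] at this
  exact ZMod.injective_stdAddChar this

/-- Orthogonality of the characters of the finite group `G_m / G_{m + n}`. -/
theorem sum_pairing_rad {m : ℤ} {n : ℕ} {x : G} (hx : x ∈ V.sub m) [Decidable (x ∈ V.sub (m + n))] :
    ∑ a, pairing (V.rad m n a) x = if x ∈ V.sub (m + n) then (p : ℂ) ^ n else 0 := by
  classical
  simp_rw [pairing_rad]
  rw [sum_stdAddChar_dot, Fintype.card_fin]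
  congr 1
  have := V.sub_combo_mem_iff (a := (0 : Fin n → ZMod p)) hx
  rw [show V.combo m n 0 = 0 by simp [combo], sub_zero] at this
  rw [this]

theorem sum_pairing_combo (m : ℤ) (n : ℕ) (a : Fin n → ZMod p) :
    ∑ b, pairing (V.rad m n a) (V.combo m n b) = if a = 0 then (p : ℂ) ^ n else 0 := by
  classical
  simp_rw [pairing_rad, digits_combo, mul_comm (a _)]
  rw [sum_stdAddChar_dot, Fintype.card_fin]

theorem pairing_charDilation (j : ℤ) (χ : Characters G) (x : G) :
    pairing (V.charDilation j χ) x = pairing χ (V.dilation j x) := rfl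

theorem charDilation_mem_iff (j k : ℤ) (χ : Characters G) :
    V.charDilation j χ ∈ V.annihilator k ↔ χ ∈ V.annihilator (k - j) := by
  simp only [mem_annihilator, pairing_charDilation]
  constructor
  · intro h x hx
    have := h (V.dilation (-j) x) ((V.dilation_mem_iff _ _ _).2 hx)
    rwa [← dilation_add, add_neg_cancel, dilation_zero] at this
  · intro h x hx
    exact h _ ((V.dilation_mem_iff _ _ _).2 (by rwa [sub_add_cancel]))

theorem charDilation_mul (j : ℤ) (χ ψ : Characters G) :
    V.charDilation j (χ * ψ) = V.charDilation j χ * V.charDilation j ψ :=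
  characters_ext fun _ => rfl

theorem charDilation_charDilation (i j : ℤ) (χ : Characters G) :
    V.charDilation i (V.charDilation j χ) = V.charDilation (j + i) χ :=
  characters_ext fun x => by simp only [pairing_charDilation, dilation_add]

theorem charDilation_zero (χ : Characters G) : V.charDilation 0 χ = χ :=
  characters_ext fun x => by simp only [pairing_charDilation, dilation_zero]

end Annihilator

/-! ### Topology of the group and of its dual -/

section Topology

variable {p : ℕ} [Fact p.Prime] {G : Type*} [AddCommGroup G] [TopologicalSpace G]
  [IsTopologicalAddGroup G] (V : VilenkinStructure p G)

theorem locallyCompactSpace (V : VilenkinStructure p G) : LocallyCompactSpace G :=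
  (V.isCompact_sub 0).locallyCompactSpace_of_mem_nhds_of_addGroup
    (V.hasBasis_nhds_zero.mem_of_mem trivial)

theorem sigmaCompactSpace (V : VilenkinStructure p G) : SigmaCompactSpace G := by
  refine ⟨⟨fun n : ℕ => V.sub (-n), fun n => V.isCompact_sub _, ?_⟩⟩
  refine Set.eq_univ_of_forall fun x => ?_
  obtain ⟨m, hm⟩ := V.exists_mem_sub x
  exact Set.mem_iUnion.2 ⟨(-m).toNat, V.sub_anti (by omega) hm⟩

/-- The countable basis at 0 makes `G` pseudometrizable, and it is σ-compact. Second countability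
serves the uniqueness of Haar measure in `exists_map_dilation_eq`. -/
theorem secondCountableTopology (V : VilenkinStructure p G) : SecondCountableTopology G := by
  have := V.sigmaCompactSpace
  have : (𝓝 (0 : G)).IsCountablyGenerated := V.hasBasis_nhds_zero.isCountablyGenerated
  let : UniformSpace G := IsTopologicalAddGroup.rightUniformSpace G
  have : IsUniformAddGroup G := isUniformAddGroup_of_addCommGroup
  have : (uniformity G).IsCountablyGenerated :=
    IsUniformAddGroup.uniformity_countably_generated
  let := UniformSpace.pseudoMetricSpace G
  exact EMetric.secondCountable_of_sigmaCompact G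

/-- The coset `y + G_k`. -/
def coset (y : G) (k : ℤ) : Set G := {x | x - y ∈ V.sub k}

theorem mem_coset {y x : G} {k : ℤ} : x ∈ V.coset y k ↔ x - y ∈ V.sub k := Iff.rfl

theorem isOpen_coset (y : G) (k : ℤ) : IsOpen (V.coset y k) :=
  (V.isOpen_sub k).preimage (continuous_id.sub continuous_const)

theorem iUnion_coset_combo (m : ℤ) (n : ℕ) :
    ⋃ a, V.coset (V.combo m n a) (m + n) = V.sub m := by
  ext x
  simp only [Set.mem_iUnion, mem_coset, SetLike.mem_coe]
  constructor
  · rintro ⟨a, ha⟩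
    have := (V.sub m).add_mem (V.sub_anti (by omega) ha) (V.combo_mem m n a)
    rwa [sub_add_cancel] at this
  · exact fun hx => ⟨_, (V.sub_combo_mem_iff hx).2 rfl⟩

theorem pairwise_disjoint_coset_combo (m : ℤ) (n : ℕ) :
    Pairwise (Function.onFun Disjoint fun a : Fin n → ZMod p =>
      V.coset (V.combo m n a) (m + n)) := by
  intro a b hab
  refine Set.disjoint_left.2 fun x hxa hxb => hab ?_
  have hx : x ∈ V.sub m := by
    rw [← SetLike.mem_coe, ← V.iUnion_coset_combo m n]
    exact Set.mem_iUnion.2 ⟨a, hxa⟩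
  exact ((V.sub_combo_mem_iff hx).1 hxa).symm.trans ((V.sub_combo_mem_iff hx).1 hxb)

theorem continuous_of_add_eq {α : Type*} [TopologicalSpace α] {f : G → α} {k : ℤ}
    (hf : ∀ x, ∀ y ∈ V.sub k, f (x + y) = f x) : Continuous f := by
  refine continuous_iff_continuousAt.2 fun x => ?_
  refine (continuousAt_const (y := f x)).congr ?_
  filter_upwards [(V.isOpen_coset x k).mem_nhds (by simp [mem_coset])] with z hz
  rw [← hf x _ hz, add_sub_cancel]

theorem continuous_of_mul_eq {α : Type*} [TopologicalSpace α] {f : Characters G → α} {k : ℤ}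
    (hf : ∀ χ, ∀ ζ ∈ V.annihilator k, f (χ * ζ) = f χ) : Continuous f := by
  refine continuous_iff_continuousAt.2 fun χ => ?_
  refine (continuousAt_const (y := f χ)).congr ?_
  have h := (V.isOpen_annihilator k).preimage (continuous_const_mul χ⁻¹)
  filter_upwards [h.mem_nhds (by simp [one_mem])] with ψ hψ
  rw [← hf χ _ hψ, mul_inv_cancel_left]

theorem hasCompactSupport_of_sub {f : G → ℂ} {m : ℤ} (hf : ∀ x, x ∉ V.sub m → f x = 0) :
    HasCompactSupport f := by
  have := V.t2Space
  exact HasCompactSupport.intro (V.isCompact_sub m) hf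

end Topology

/-! ### Haar measure of cosets and integrals over them -/

section Measure

variable {p : ℕ} [Fact p.Prime] {G : Type*} [AddCommGroup G] [TopologicalSpace G]
  [IsTopologicalAddGroup G] [MeasurableSpace G] [BorelSpace G] (V : VilenkinStructure p G)
  (μ : Measure G) [μ.IsAddHaarMeasure]

theorem measurableSet_coset (y : G) (k : ℤ) : MeasurableSet (V.coset y k) :=
  (V.isOpen_coset y k).measurableSet

theorem measurableSet_sub (k : ℤ) : MeasurableSet (V.sub k : Set G) :=
  (V.isOpen_sub k).measurableSet

theorem measure_sub_lt_top (k : ℤ) : μ (V.sub k : Set G) < ∞ :=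
  (V.isCompact_sub k).measure_lt_top

theorem measure_coset (y : G) (k : ℤ) : μ (V.coset y k) = μ (V.sub k : Set G) :=
  (measurePreserving_sub_right μ y).measure_preimage (V.measurableSet_sub k).nullMeasurableSet

theorem measure_sub_eq (m : ℤ) (n : ℕ) :
    μ (V.sub m : Set G) = p ^ n * μ (V.sub (m + n) : Set G) := by
  rw [← V.iUnion_coset_combo m n, measure_iUnion (V.pairwise_disjoint_coset_combo m n)
    fun a => V.measurableSet_coset _ _, tsum_fintype]
  simp [measure_coset, ZMod.card]

theorem real_sub {μ : Measure G} [μ.IsAddHaarMeasure] (hμ : μ (V.sub 0 : Set G) = 1) (m : ℤ) :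
    μ.real (V.sub m : Set G) = (p : ℝ) ^ (-m) := by
  have hp : (p : ℝ) ≠ 0 := by exact_mod_cast (Fact.out : p.Prime).ne_zero
  rcases le_total 0 m with h | h
  · obtain ⟨n, rfl⟩ := Int.eq_ofNat_of_zero_le h
    have := V.measure_sub_eq μ 0 n
    rw [hμ, zero_add] at this
    have := congrArg ENNReal.toReal this
    rw [ENNReal.toReal_one, ENNReal.toReal_mul, ENNReal.toReal_pow, ENNReal.toReal_natCast] at this
    rw [zpow_neg, zpow_natCast]
    exact eq_inv_of_mul_eq_one_right this.symm
  · obtain ⟨n, rfl⟩ : ∃ n : ℕ, m = -n := ⟨(-m).toNat, by omega⟩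
    rw [measureReal_def, V.measure_sub_eq μ (-n) n, neg_add_cancel, hμ]
    simp

theorem setIntegral_sub_eq_sum {f : G → ℂ} {m : ℤ} (n : ℕ) (hf : IntegrableOn f (V.sub m) μ) :
    ∫ x in (V.sub m : Set G), f x ∂μ = ∑ a, ∫ x in V.coset (V.combo m n a) (m + n), f x ∂μ := by
  rw [← V.iUnion_coset_combo m n] at hf ⊢
  exact integral_iUnion_fintype (fun a => V.measurableSet_coset _ _)
    (V.pairwise_disjoint_coset_combo m n) fun a => hf.mono_set (Set.subset_iUnion_of_subset a le_rfl)

variable {μ}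

theorem memLp_locallyIntegrable {f : G → ℂ} (V : VilenkinStructure p G) (hf : MemLp f 2 μ) :
    LocallyIntegrable f μ := by
  have := V.locallyCompactSpace
  exact hf.locallyIntegrable (by norm_num)

/-- A compact set is the decreasing intersection of its saturations by small subgroups, and each
saturation is a finite disjoint union of cosets. Vanishing on cosets thus passes to compact sets by
dominated convergence. -/
theorem ae_eq_zero_of_setIntegral_coset {f : G → ℂ} (hf : LocallyIntegrable f μ)
    (h : ∀ y k, ∫ x in V.coset y k, f x ∂μ = 0) : f =ᵐ[μ] 0 := by
  classical
  have := V.sigmaCompactSpace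
  have := V.t2Space
  refine ae_eq_zero_of_forall_setIntegral_isCompact_eq_zero' hf fun K hK => ?_
  obtain ⟨m, hm⟩ : ∃ m : ℕ, K ⊆ V.sub (-m) := by
    refine hK.elim_directed_cover (fun n : ℕ => (V.sub (-n) : Set G)) (fun n => V.isOpen_sub _)
      (fun x _ => ?_) (directed_of_isDirected_le fun i j hij => V.sub_anti (by omega))
    obtain ⟨m, hm⟩ := V.exists_mem_sub x
    exact Set.mem_iUnion.2 ⟨(-m).toNat, V.sub_anti (by omega) hm⟩
  -- `t n` is K + G_{-m+n}, the saturation of K.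
  let t : ℕ → Set G := fun n => {x | ∃ y ∈ K, x - y ∈ V.sub (-m + n)}
  have ht : ∀ n, t n = ⋃ a ∈ Finset.univ.filter
      (fun a : Fin n → ZMod p => ∃ y ∈ K, y ∈ V.coset (V.combo (-m) n a) (-m + n)),
      V.coset (V.combo (-m) n a) (-m + n) := by
    intro n
    ext x
    simp only [t, Set.mem_ofPred_eq, Finset.mem_filter, Finset.mem_univ, true_and,
      Set.mem_iUnion, exists_prop]
    constructor
    · rintro ⟨y, hy, hxy⟩
      have hy' : y ∈ ⋃ a, V.coset (V.combo (-m) n a) (-m + n) := by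
        rw [iUnion_coset_combo]; exact hm hy
      obtain ⟨a, ha⟩ := Set.mem_iUnion.1 hy'
      refine ⟨a, ⟨y, hy, ha⟩, ?_⟩
      have := (V.sub _).add_mem hxy ha
      rwa [sub_add_sub_cancel] at this
    · rintro ⟨a, ⟨y, hy, ha⟩, hx⟩
      refine ⟨y, hy, ?_⟩
      have := (V.sub _).sub_mem hx ha
      rwa [sub_sub_sub_cancel_right] at this
  have htm : ∀ n, MeasurableSet (t n) := fun n => by
    rw [ht]
    exact Finset.measurableSet_biUnion _ fun a _ => V.measurableSet_coset _ _
  have hloc : ∀ n : ℕ, IntegrableOn f (V.sub (-m)) μ := fun n =>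
    hf.integrableOn_isCompact (V.isCompact_sub _)
  have h0 : ∀ n, ∫ x in t n, f x ∂μ = 0 := by
    intro n
    rw [ht, integral_biUnion_finset _ (fun a _ => V.measurableSet_coset _ _)
      (fun a _ b _ hab => V.pairwise_disjoint_coset_combo (-m) n hab)]
    · exact Finset.sum_eq_zero fun a _ => h _ _
    · intro a _
      refine (hloc n).mono_set ?_
      rw [← V.iUnion_coset_combo (-m) n]
      exact Set.subset_iUnion_of_subset a le_rfl
  have hanti : Antitone t := by
    rintro i j hij x ⟨y, hy, hxy⟩
    exact ⟨y, hy, V.sub_anti (by omega) hxy⟩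
  have hlim := tendsto_setIntegral_of_antitone htm hanti
    ⟨0, (hloc 0).mono_set (by
      rintro x ⟨y, hy, hxy⟩
      have := (V.sub (-m)).add_mem (V.sub_anti (by omega) hxy) (hm hy)
      rwa [sub_add_cancel] at this)⟩
  have hK' : ⋂ n, t n = K := by
    refine Set.Subset.antisymm (fun x hx => ?_) (Set.subset_iInter fun n y hy => ⟨y, hy, by simp⟩)
    rw [← hK.isClosed.closure_eq, mem_closure_iff_nhds]
    intro U hU
    have hU' : (fun z => x - z) ⁻¹' U ∈ 𝓝 (0 : G) := by
      refine (continuous_const.sub continuous_id).continuousAt.preimage_mem_nhds ?_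
      simpa using hU
    obtain ⟨n, -, hn⟩ := V.hasBasis_nhds_zero.mem_iff.1 hU'
    obtain ⟨y, hy, hxy⟩ := Set.mem_iInter.1 hx (n + m).toNat
    refine ⟨y, ?_, hy⟩
    have := hn (V.sub_anti (by omega) hxy : x - y ∈ V.sub n)
    simpa using this
  simp_rw [h0, hK'] at hlim
  exact (tendsto_const_nhds_iff.1 hlim).symm

theorem integrableOn_mul_pairing {f : G → ℂ} {s : Set G} (hf : IntegrableOn f s μ)
    (χ : Characters G) : IntegrableOn (fun x => f x * conj (pairing χ x)) s μ := by
  refine Integrable.congr' hf (hf.aestronglyMeasurable.mul ?_) ?_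
  · exact (Complex.continuous_conj.comp (continuous_pairing χ)).aestronglyMeasurable
  · exact Eventually.of_forall fun x => by simp [norm_pairing]

-- If χ(y) ≠ 1 for some y in G_m, translation by y preserves the integral and also multiplies it by
-- χ(y), so it is zero.
open Classical in
theorem setIntegral_pairing (χ : Characters G) (m : ℤ) :
    ∫ x in (V.sub m : Set G), pairing χ x ∂μ =
      if χ ∈ V.annihilator m then (μ.real (V.sub m : Set G) : ℂ) else 0 := by
  split_ifs with h
  · rw [setIntegral_congr_fun (g := fun _ => (1 : ℂ)) (V.measurableSet_sub m) fun x hx => h x hx]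
    simp
  · rw [mem_annihilator] at h
    push Not at h
    obtain ⟨y, hy, hne⟩ := h
    have h1 : ∫ x in (V.sub m : Set G), pairing χ x ∂μ =
        pairing χ y * ∫ x in (V.sub m : Set G), pairing χ x ∂μ := by
      rw [← integral_const_mul, ← integral_indicator (V.measurableSet_sub m),
        ← integral_indicator (V.measurableSet_sub m), ← integral_add_right_eq_self _ y]
      congr 1
      funext x
      have hiff : x + y ∈ V.sub m ↔ x ∈ V.sub m := (V.sub m).add_mem_cancel_right hy
      by_cases hx : x ∈ V.sub m
      · rw [Set.indicator_of_mem (SetLike.mem_coe.2 (hiff.2 hx)), Set.indicator_of_mem (SetLike.mem_coe.2 hx),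
          pairing_add, mul_comm]
      · rw [Set.indicator_of_notMem (fun h => hx (hiff.1 h)), Set.indicator_of_notMem hx]
    have h2 : (1 - pairing χ y) * ∫ x in (V.sub m : Set G), pairing χ x ∂μ = 0 := by
      rw [sub_mul, one_mul, ← h1, sub_self]
    exact (mul_eq_zero.1 h2).resolve_left (sub_ne_zero.2 (Ne.symm hne))

end Measure

/-! ### Haar measure on the dual group -/

section DualMeasure

variable {p : ℕ} [Fact p.Prime] {G : Type*} [AddCommGroup G] [TopologicalSpace G]
  [IsTopologicalAddGroup G] (V : VilenkinStructure p G)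
  [MeasurableSpace (Characters G)] [BorelSpace (Characters G)]
  (ν : Measure (Characters G)) [ν.IsHaarMeasure]

/-- The coset `ψ G_k^⊥`. -/
def dualCoset (ψ : Characters G) (k : ℤ) : Set (Characters G) := {χ | χ * ψ⁻¹ ∈ V.annihilator k}

theorem measurableSet_annihilator (k : ℤ) : MeasurableSet (V.annihilator k : Set (Characters G)) :=
  (V.isOpen_annihilator k).measurableSet

theorem measurableSet_dualCoset (ψ : Characters G) (k : ℤ) : MeasurableSet (V.dualCoset ψ k) :=
  ((V.isOpen_annihilator k).preimage (continuous_mul_const ψ⁻¹)).measurableSet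

theorem measure_dualCoset (ψ : Characters G) (k : ℤ) :
    ν (V.dualCoset ψ k) = ν (V.annihilator k : Set (Characters G)) :=
  measure_preimage_mul_right ν ψ⁻¹ _

theorem iUnion_dualCoset_rad (m : ℤ) (n : ℕ) :
    ⋃ a, V.dualCoset (V.rad m n a) m = V.annihilator (m + n) := by
  ext χ
  simp only [Set.mem_iUnion, SetLike.mem_coe]
  constructor
  · rintro ⟨a, ha⟩
    have := mul_mem (V.annihilator_mono (by omega) ha) (V.rad_mem_annihilator m n a)
    rwa [inv_mul_cancel_right] at this
  · exact fun h => V.exists_mul_inv_rad_mem h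

theorem pairwise_disjoint_dualCoset_rad (m : ℤ) (n : ℕ) :
    Pairwise (Function.onFun Disjoint fun a : Fin n → ZMod p => V.dualCoset (V.rad m n a) m) := by
  intro a b hab
  refine Set.disjoint_left.2 fun χ ha hb => hab (V.rad_mul_inv_rad_mem (m := m) ?_)
  have ha : χ * (V.rad m n a)⁻¹ ∈ V.annihilator m := ha
  have hb : χ * (V.rad m n b)⁻¹ ∈ V.annihilator m := hb
  have := mul_mem (inv_mem ha) hb
  have h2 : (χ * (V.rad m n a)⁻¹)⁻¹ * (χ * (V.rad m n b)⁻¹) = V.rad m n a * (V.rad m n b)⁻¹ := by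
    rw [mul_inv, inv_inv, mul_comm χ⁻¹, mul_assoc, inv_mul_cancel_left]
  rwa [h2] at this

theorem measure_annihilator_add (m : ℤ) (n : ℕ) :
    ν (V.annihilator (m + n) : Set (Characters G)) =
      p ^ n * ν (V.annihilator m : Set (Characters G)) := by
  rw [← V.iUnion_dualCoset_rad m n, measure_iUnion (V.pairwise_disjoint_dualCoset_rad m n)
    fun a => V.measurableSet_dualCoset _ _, tsum_fintype]
  simp [measure_dualCoset, ZMod.card]

variable {ν}

/-- Finiteness is deduced from the normalisation, since G_m^⊥ is covered by finitely many cosets of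
G_0^⊥; compactness of annihilators is never used. -/
theorem measure_annihilator_lt_top (hν : ν (V.annihilator 0 : Set (Characters G)) = 1) (m : ℤ) :
    ν (V.annihilator m : Set (Characters G)) < ∞ := by
  refine (measure_mono (V.annihilator_mono (n := 0 + (m.toNat : ℕ)) (by omega))).trans_lt ?_
  rw [measure_annihilator_add, hν, mul_one]
  exact ENNReal.pow_lt_top (ENNReal.natCast_lt_top p)

theorem real_annihilator (hν : ν (V.annihilator 0 : Set (Characters G)) = 1) (m : ℤ) :
    ν.real (V.annihilator m : Set (Characters G)) = (p : ℝ) ^ m := by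
  rcases le_total 0 m with h | h
  · obtain ⟨n, rfl⟩ := Int.eq_ofNat_of_zero_le h
    have := V.measure_annihilator_add ν 0 n
    rw [hν, zero_add] at this
    rw [measureReal_def, this]
    simp
  · obtain ⟨n, rfl⟩ : ∃ n : ℕ, m = -n := ⟨(-m).toNat, by omega⟩
    have := V.measure_annihilator_add ν (-n) n
    rw [neg_add_cancel, hν] at this
    have := congrArg ENNReal.toReal this
    rw [ENNReal.toReal_one, ENNReal.toReal_mul, ENNReal.toReal_pow, ENNReal.toReal_natCast] at this
    rw [zpow_neg, zpow_natCast]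
    exact eq_inv_of_mul_eq_one_right this.symm

theorem setIntegral_annihilator (hν : ν (V.annihilator 0 : Set (Characters G)) = 1)
    {g : Characters G → ℂ} {m : ℤ} (n : ℕ) (hg : ∀ χ, ∀ ζ ∈ V.annihilator m, g (χ * ζ) = g χ) :
    ∫ χ in (V.annihilator (m + n) : Set (Characters G)), g χ ∂ν =
      ((p : ℝ) ^ m : ℝ) * ∑ a, g (V.rad m n a) := by
  have hcongr : ∀ ψ, Set.EqOn g (fun _ => g ψ) (V.dualCoset ψ m) := by
    intro ψ χ hχ
    rw [← hg ψ _ hχ, mul_comm χ, mul_inv_cancel_left]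
  have hfin : ∀ ψ, ν (V.dualCoset ψ m) < ∞ := fun ψ => by
    rw [measure_dualCoset]
    exact V.measure_annihilator_lt_top hν m
  rw [← V.iUnion_dualCoset_rad m n,
    integral_iUnion_fintype (fun a => V.measurableSet_dualCoset _ _)
      (V.pairwise_disjoint_dualCoset_rad m n), Finset.mul_sum]
  · refine Finset.sum_congr rfl fun a _ => ?_
    rw [setIntegral_congr_fun (V.measurableSet_dualCoset _ _) (hcongr _), setIntegral_const,
      measureReal_def, measure_dualCoset, ← measureReal_def, V.real_annihilator hν]
    exact Complex.real_smul
  · intro a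
    exact (integrableOn_const (hfin _).ne).congr_fun (hcongr _).symm (V.measurableSet_dualCoset _ _)

end DualMeasure

/-! ### Uniqueness of the inverse Fourier transform -/

section FourierUniqueness

variable {p : ℕ} [Fact p.Prime] {G : Type*} [AddCommGroup G] [TopologicalSpace G]
  [IsTopologicalAddGroup G] [MeasurableSpace G] [BorelSpace G] (V : VilenkinStructure p G)
  [MeasurableSpace (Characters G)] [BorelSpace (Characters G)]
  {μ : Measure G} [μ.IsAddHaarMeasure] {ν : Measure (Characters G)} [ν.IsHaarMeasure]

variable (μ) in
/-- The Fourier transform of `f` truncated to `G_m`. -/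
noncomputable def truncFourier (f : G → ℂ) (m : ℤ) (χ : Characters G) : ℂ :=
  ∫ x in (V.sub m : Set G), f x * conj (pairing χ x) ∂μ

theorem truncFourier_mul (f : G → ℂ) (m : ℤ) (χ : Characters G) {ζ : Characters G}
    (hζ : ζ ∈ V.annihilator m) : V.truncFourier μ f m (χ * ζ) = V.truncFourier μ f m χ := by
  refine setIntegral_congr_fun (V.measurableSet_sub m) fun x hx => ?_
  simp only [pairing_mul, hζ x hx, mul_one]

theorem continuous_truncFourier (f : G → ℂ) (m : ℤ) : Continuous (V.truncFourier μ f m) :=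
  V.continuous_of_mul_eq fun χ _ hζ => V.truncFourier_mul f m χ hζ

/-- Finite Fourier inversion: with the sum moved inside the integral, the kernel ∑ₐ (rad a, y - x)
is p^n times the indicator of the coset of y modulo G_{m+n}. -/
theorem sum_truncFourier_rad {f : G → ℂ} {m : ℤ} (n : ℕ) (hf : IntegrableOn f (V.sub m) μ) {y : G}
    (hy : y ∈ V.sub m) :
    ∑ a, V.truncFourier μ f m (V.rad m n a) * pairing (V.rad m n a) y =
      (p : ℂ) ^ n * ∫ x in V.coset y (m + n), f x ∂μ := by
  classical
  simp_rw [truncFourier, ← integral_mul_const]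
  rw [← integral_finsetSum _ fun a _ => (integrableOn_mul_pairing hf _).mul_const _,
    ← integral_const_mul]
  have hsub : V.coset y (m + n) ⊆ V.sub m := fun x hx => by
    have := (V.sub m).add_mem (V.sub_anti (by omega) hx) hy
    rwa [sub_add_cancel] at this
  rw [← Set.inter_eq_self_of_subset_right hsub, ← setIntegral_indicator (V.measurableSet_coset _ _)]
  refine setIntegral_congr_fun (V.measurableSet_sub m) fun x hx => ?_
  have h1 : ∀ a, f x * conj (pairing (V.rad m n a) x) * pairing (V.rad m n a) y =
      f x * pairing (V.rad m n a) (y - x) := fun a => by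
    rw [pairing_sub, conj_pairing]; ring
  simp only [h1]
  rw [← Finset.mul_sum, V.sum_pairing_rad ((V.sub m).sub_mem hy hx)]
  have h2 : y - x ∈ V.sub (m + n) ↔ x ∈ V.coset y (m + n) := by
    rw [mem_coset, ← neg_sub, neg_mem_iff]
  by_cases hx' : x ∈ V.coset y (m + n)
  · rw [if_pos (h2.2 hx'), Set.indicator_of_mem hx', mul_comm]
  · rw [if_neg (fun h => hx' (h2.1 h)), Set.indicator_of_notMem hx', mul_zero]

theorem setIntegral_truncFourier (hν : ν (V.annihilator 0 : Set (Characters G)) = 1) {f : G → ℂ}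
    {m : ℤ} (n : ℕ) (hf : IntegrableOn f (V.sub m) μ) {y : G} (hy : y ∈ V.sub m) :
    ∫ χ in (V.annihilator (m + n) : Set (Characters G)), V.truncFourier μ f m χ * pairing χ y ∂ν =
      ((p : ℝ) ^ (m + n) : ℝ) * ∫ x in V.coset y (m + n), f x ∂μ := by
  have hp : (p : ℝ) ≠ 0 := by exact_mod_cast (Fact.out : p.Prime).ne_zero
  rw [V.setIntegral_annihilator hν, V.sum_truncFourier_rad n hf hy, zpow_add₀ hp]
  · push_cast
    rw [zpow_natCast]
    ring
  · intro χ ζ hζ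
    rw [truncFourier_mul _ _ _ _ hζ, pairing_mul, hζ y hy, mul_one]

/-- Cauchy–Schwarz on G_k^⊥, using |(χ, y)| = 1. The measure factor does not depend on the
truncation level m. -/
theorem enorm_setIntegral_truncFourier_le (f : G → ℂ) (m k : ℤ) (y : G) :
    ‖∫ χ in (V.annihilator k : Set (Characters G)), V.truncFourier μ f m χ * pairing χ y ∂ν‖ₑ ≤
      eLpNorm (V.truncFourier μ f m) 2 ν *
        ν (V.annihilator k : Set (Characters G)) ^ (1 / 2 : ℝ) := by
  set s := (V.annihilator k : Set (Characters G))
  calc ‖∫ χ in s, V.truncFourier μ f m χ * pairing χ y ∂ν‖ₑ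
      ≤ ∫⁻ χ in s, ‖V.truncFourier μ f m χ * pairing χ y‖ₑ ∂ν := enorm_integral_le_lintegral_enorm _
    _ = eLpNorm (V.truncFourier μ f m) 1 (ν.restrict s) := by
        rw [eLpNorm_one_eq_lintegral_enorm]
        refine lintegral_congr fun χ => ?_
        rw [← enorm_norm, norm_mul, norm_pairing, mul_one, enorm_norm]
    _ ≤ eLpNorm (V.truncFourier μ f m) 2 (ν.restrict s) * ν s ^ (1 / 2 : ℝ) := by
        have := eLpNorm_le_eLpNorm_mul_rpow_measure_univ (μ := ν.restrict s) (p := 1) (q := 2)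
          (by norm_num) (V.continuous_truncFourier (μ := μ) f m).aestronglyMeasurable
        rw [Measure.restrict_apply_univ] at this
        convert this using 3
        norm_num
    _ ≤ _ := by
        gcongr
        exact Measure.restrict_le_self

/-- A square integrable function whose truncated Fourier transforms tend to zero vanishes. -/
theorem ae_eq_zero_of_tendsto_truncFourier
    (hν : ν (V.annihilator 0 : Set (Characters G)) = 1) {f : G → ℂ} (hf : MemLp f 2 μ)
    (h : Tendsto (fun n : ℕ => eLpNorm (V.truncFourier μ f (-n)) 2 ν) atTop (𝓝 0)) :
    f =ᵐ[μ] 0 := by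
  have hp : (p : ℝ) ≠ 0 := by exact_mod_cast (Fact.out : p.Prime).ne_zero
  have hloc := memLp_locallyIntegrable V hf
  refine V.ae_eq_zero_of_setIntegral_coset hloc fun y k => ?_
  have hC := ENNReal.Tendsto.mul_const (b := ν (V.annihilator k : Set (Characters G)) ^ (1 / 2 : ℝ))
    h (Or.inr (ENNReal.rpow_ne_top_of_nonneg (by norm_num)
      (V.measure_annihilator_lt_top hν k).ne))
  rw [zero_mul] at hC
  -- The left side is independent of n, yet for all large n it equals an integral of the transform
  -- truncated to G_{-n}, which is bounded by a quantity tending to 0.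
  have hle : ‖((p : ℝ) ^ k : ℝ) * ∫ x in V.coset y k, f x ∂μ‖ₑ ≤ 0 := by
    refine ge_of_tendsto hC ?_
    obtain ⟨m, hm⟩ := V.exists_mem_sub y
    filter_upwards [eventually_ge_atTop (max (-m) (-k)).toNat] with n hn
    have hy : y ∈ V.sub (-n) := V.sub_anti (by omega) hm
    obtain ⟨j, hj⟩ : ∃ j : ℕ, k = -n + j := ⟨(k + n).toNat, by omega⟩
    have := V.enorm_setIntegral_truncFourier_le (μ := μ) (ν := ν) f (-n) k y
    rw [hj, V.setIntegral_truncFourier hν j (hloc.integrableOn_isCompact (V.isCompact_sub _)) hy]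
      at this
    rwa [← hj] at this
  have h0 : ((p : ℝ) ^ k : ℝ) * ∫ x in V.coset y k, f x ∂μ = (0 : ℂ) := by simpa using hle
  refine (mul_eq_zero.1 h0).resolve_left ?_
  exact_mod_cast zpow_ne_zero k hp

theorem IsFourierTransform.ae_eq {V : VilenkinStructure p G}
    (hν : ν (V.annihilator 0 : Set (Characters G)) = 1) {f g : G → ℂ} {F : Characters G → ℂ}
    (hf : V.IsFourierTransform μ ν f F) (hg : V.IsFourierTransform μ ν g F) : f =ᵐ[μ] g := by
  have hsub := hf.1.sub hg.1
  have hF := hf.2.1.aestronglyMeasurable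
  have : f - g =ᵐ[μ] 0 := by
    refine V.ae_eq_zero_of_tendsto_truncFourier hν hsub ?_
    have hadd := hf.2.2.add hg.2.2
    rw [add_zero] at hadd
    refine tendsto_of_tendsto_of_tendsto_of_le_of_le tendsto_const_nhds hadd (fun _ => zero_le)
      fun n => ?_
    -- F cancels: the truncated transform of f - g is the difference of the two approximation
    -- errors.
    have h1 : V.truncFourier μ (f - g) (-n) =
        (fun χ => V.truncFourier μ f (-n) χ - F χ) - fun χ => V.truncFourier μ g (-n) χ - F χ := by
      funext χ
      simp only [Pi.sub_apply, sub_sub_sub_cancel_right, truncFourier, sub_mul]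
      exact integral_sub
        (integrableOn_mul_pairing ((memLp_locallyIntegrable V hf.1).integrableOn_isCompact
          (V.isCompact_sub _)) χ)
        (integrableOn_mul_pairing ((memLp_locallyIntegrable V hg.1).integrableOn_isCompact
          (V.isCompact_sub _)) χ)
    rw [h1]
    exact eLpNorm_sub_le ((V.continuous_truncFourier f _).aestronglyMeasurable.sub hF)
      ((V.continuous_truncFourier g _).aestronglyMeasurable.sub hF) (by norm_num)
  filter_upwards [this] with x hx
  exact sub_eq_zero.1 hx

theorem IsFourierTransform.congr_ae {V : VilenkinStructure p G} {f g : G → ℂ}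
    {F : Characters G → ℂ} (hf : V.IsFourierTransform μ ν f F) (hfg : f =ᵐ[μ] g) :
    V.IsFourierTransform μ ν g F := by
  refine ⟨(memLp_congr_ae hfg).1 hf.1, hf.2.1, hf.2.2.congr fun n => ?_⟩
  congr 1
  funext χ
  congr 1
  refine integral_congr_ae (ae_restrict_of_ae ?_)
  filter_upwards [hfg] with x hx
  rw [hx]

/-- The Fourier transform of a function supported in `G_m` is given by an integral. -/
theorem isFourierTransform_of_support {f : G → ℂ} {F : Characters G → ℂ} (hf : MemLp f 2 μ)
    (hF : MemLp F 2 ν) {m : ℤ} (hs : ∀ x, x ∉ V.sub m → f x = 0)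
    (h : ∀ χ, V.truncFourier μ f m χ = F χ) : V.IsFourierTransform μ ν f F := by
  refine ⟨hf, hF, tendsto_const_nhds.congr' ?_⟩
  filter_upwards [eventually_ge_atTop (-m).toNat] with n hn
  have h1 : ∀ χ, ∫ x in (V.sub (-n) : Set G), f x * conj (pairing χ x) ∂μ = F χ := by
    intro χ
    rw [← h, truncFourier]
    refine setIntegral_eq_of_subset_of_forall_sdiff_eq_zero (V.measurableSet_sub _)
      (V.sub_anti (by omega)) fun x hx => ?_
    rw [hs x hx.2, zero_mul]
  simp [h1]

/-- A compactly supported function with vanishing Fourier transform vanishes. -/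
theorem ae_eq_zero_of_truncFourier_eq_zero
    (hν : ν (V.annihilator 0 : Set (Characters G)) = 1) {f : G → ℂ} (hf : MemLp f 2 μ)
    {m : ℤ} (hs : ∀ x, x ∉ V.sub m → f x = 0) (h : ∀ χ, V.truncFourier μ f m χ = 0) :
    f =ᵐ[μ] 0 := by
  have h0 : V.IsFourierTransform μ ν (0 : G → ℂ) 0 :=
    V.isFourierTransform_of_support (m := 0) MemLp.zero' MemLp.zero' (by simp)
      (by simp [truncFourier])
  exact IsFourierTransform.ae_eq hν
    (V.isFourierTransform_of_support hf MemLp.zero' hs h) h0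

end FourierUniqueness

/-! ### Dilations and translations on L₂ -/

section Operators

variable {p : ℕ} [Fact p.Prime] {G : Type*} [AddCommGroup G] [TopologicalSpace G]
  [IsTopologicalAddGroup G] [MeasurableSpace G] [BorelSpace G] (V : VilenkinStructure p G)
  (μ : Measure G) [μ.IsAddHaarMeasure]

/-- The powers of the dilation operator as homeomorphisms. -/
noncomputable def dilationHomeomorph (j : ℤ) : G ≃ₜ G where
  toEquiv := (V.dilation j).toEquiv
  continuous_toFun := V.continuous_dilation j
  continuous_invFun := by
    have h : (V.dilation j).toEquiv.invFun = V.dilation (-j) := rfl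
    rw [h]
    exact V.continuous_dilation (-j)

theorem dilation_neg_dilation (j : ℤ) (x : G) : V.dilation (-j) (V.dilation j x) = x := by
  rw [← dilation_add, neg_add_cancel, dilation_zero]

theorem dilation_dilation_neg (j : ℤ) (x : G) : V.dilation j (V.dilation (-j) x) = x := by
  rw [← dilation_add, add_neg_cancel, dilation_zero]

theorem measurableEmbedding_dilation (j : ℤ) : MeasurableEmbedding (V.dilation j) :=
  (V.dilationHomeomorph j).measurableEmbedding

/-- Uniqueness of Haar measure. The exact factor is never needed, only that it is nonzero and
finite. -/
theorem exists_map_dilation_eq (j : ℤ) :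
    ∃ c : ℝ≥0∞, c ≠ 0 ∧ c ≠ ∞ ∧ μ.map (V.dilation j) = c • μ := by
  have := V.locallyCompactSpace
  have := V.secondCountableTopology
  have : (μ.map (V.dilation j)).IsAddHaarMeasure :=
    (V.dilation j).isAddHaarMeasure_map μ (V.continuous_dilation j)
      (V.dilationHomeomorph j).symm.continuous
  have h := Measure.isAddLeftInvariant_eq_smul (μ.map (V.dilation j)) μ
  refine ⟨(Measure.addHaarScalarFactor (μ.map (V.dilation j)) μ : ℝ≥0∞), ?_, ENNReal.coe_ne_top, h⟩
  exact ENNReal.coe_ne_zero.2 (Measure.addHaarScalarFactor_pos_of_isAddHaarMeasure _ _).ne'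

theorem quasiMeasurePreserving_dilation (j : ℤ) :
    Measure.QuasiMeasurePreserving (V.dilation j) μ μ := by
  obtain ⟨c, -, -, hc⟩ := V.exists_map_dilation_eq μ j
  exact ⟨(V.measurableEmbedding_dilation j).measurable, hc ▸ Measure.smul_absolutelyContinuous⟩

theorem quasiMeasurePreserving_dilation_sub (j : ℤ) (h : G) :
    Measure.QuasiMeasurePreserving (fun x => V.dilation j x - h) μ μ :=
  (measurePreserving_sub_right μ h).quasiMeasurePreserving.comp
    (V.quasiMeasurePreserving_dilation μ j)

variable {μ}

theorem memLp_comp_dilation {f : G → ℂ} (hf : MemLp f 2 μ) (j : ℤ) :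
    MemLp (fun x => f (V.dilation j x)) 2 μ := by
  obtain ⟨c, -, hct, hc⟩ := V.exists_map_dilation_eq μ j
  have h : MemLp f 2 (μ.map (V.dilation j)) := hc ▸ hf.smul_measure hct
  exact (V.measurableEmbedding_dilation j).memLp_map_measure_iff.1 h

theorem integral_comp_dilation (j : ℤ) :
    ∃ c : ℝ, c ≠ 0 ∧ ∀ f : G → ℂ, ∫ x, f (V.dilation j x) ∂μ = c * ∫ x, f x ∂μ := by
  obtain ⟨c, hc0, hct, hc⟩ := V.exists_map_dilation_eq μ j
  refine ⟨c.toReal, (ENNReal.toReal_pos hc0 hct).ne', fun f => ?_⟩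
  rw [← (V.measurableEmbedding_dilation j).integral_map, hc, integral_smul_measure,
    Complex.real_smul]

variable (μ)

/-- The operator `F ↦ F ∘ 𝒜^j` on `L₂(G)`. -/
noncomputable def dilationLp (j : ℤ) : Lp ℂ 2 μ →L[ℂ] Lp ℂ 2 μ :=
  (LinearMap.mkContinuousOfExistsBound
    { toFun := fun F => (V.memLp_comp_dilation (Lp.memLp F) j).toLp fun x => F (V.dilation j x)
      map_add' := fun F H => by
        rw [← MemLp.toLp_add]
        exact MemLp.toLp_congr _ _
          ((V.quasiMeasurePreserving_dilation μ j).ae (Lp.coeFn_add F H))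
      map_smul' := fun a F => by
        rw [RingHom.id_apply, ← MemLp.toLp_const_smul]
        exact MemLp.toLp_congr _ _
          ((V.quasiMeasurePreserving_dilation μ j).ae (Lp.coeFn_smul a F)) } <| by
    obtain ⟨c, hc0, hct, hc⟩ := V.exists_map_dilation_eq μ j
    refine ⟨(c ^ (1 / (2 : ℝ≥0∞)).toReal).toReal, fun F => le_of_eq ?_⟩
    change ‖(V.memLp_comp_dilation (Lp.memLp F) j).toLp _‖ = _
    rw [Lp.norm_toLp, Lp.norm_def, ← ENNReal.toReal_mul]
    congr 1
    rw [← smul_eq_mul, ← eLpNorm_smul_measure_of_ne_zero hc0, ← hc,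
      (V.measurableEmbedding_dilation j).eLpNorm_map_measure]
    rfl)

theorem dilationLp_ae (j : ℤ) (F : Lp ℂ 2 μ) :
    V.dilationLp μ j F =ᵐ[μ] fun x => F (V.dilation j x) :=
  MemLp.coeFn_toLp (V.memLp_comp_dilation (Lp.memLp F) j)

variable {V}

variable (y : G)

/-- The translation `F ↦ F(· - y)` on `L₂(G)`. -/
noncomputable def translateLp : Lp ℂ 2 μ →ₗᵢ[ℂ] Lp ℂ 2 μ :=
  Lp.compMeasurePreservingₗᵢ ℂ (fun x => x - y) (measurePreserving_sub_right μ y)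

theorem translateLp_ae (F : Lp ℂ 2 μ) : translateLp μ y F =ᵐ[μ] fun x => F (x - y) :=
  Lp.coeFn_compMeasurePreserving F (measurePreserving_sub_right μ y)

variable {μ}

/-- The only square integrable function invariant under all translations is zero. -/
theorem eq_zero_of_forall_translateLp_eq (hμ : μ (V.sub 0 : Set G) = 1) {F : Lp ℂ 2 μ}
    (hF : ∀ y, translateLp μ y F = F) : F = 0 := by
  have hloc := memLp_locallyIntegrable V (Lp.memLp F)
  have hcoset : ∀ y k, ∫ x in V.coset y k, F x ∂μ = ∫ x in (V.sub k : Set G), F x ∂μ := by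
    intro y k
    refine Eq.trans ?_ ((measurePreserving_sub_right μ y).setIntegral_preimage_emb
      (measurableEmbedding_subRight y) F (V.sub k))
    refine setIntegral_congr_ae (V.measurableSet_coset y k) ?_
    filter_upwards [translateLp_ae μ y F] with x hx _
    rw [hF] at hx
    exact hx
  refine Lp.ext (.trans (V.ae_eq_zero_of_setIntegral_coset hloc fun y k => ?_)
    (Lp.coeFn_zero _ _ _).symm)
  rw [hcoset]
  set I := ∫ x in (V.sub k : Set G), F x ∂μ with hI
  have hp : (1 : ℝ) < p := by exact_mod_cast (Fact.out : p.Prime).one_lt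
  have hp0 : (p : ℝ) ≠ 0 := by positivity
  -- By invariance the integral over G_{k-n} is p^n I, while the indicator of G_{k-n} has squared
  -- norm p^{n-k}. Cauchy–Schwarz gives the bound after division by p^n; letting n grow forces I =
  -- 0.
  have hbound : ∀ n : ℕ, (p : ℝ) ^ n * ‖I‖ ^ 2 ≤ ‖F‖ ^ 2 * (p : ℝ) ^ (-k) := by
    intro n
    have h1 : ∫ x in (V.sub (k - n) : Set G), F x ∂μ = (p : ℂ) ^ n * I := by
      rw [V.setIntegral_sub_eq_sum μ n (hloc.integrableOn_isCompact (V.isCompact_sub _))]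
      simp [hcoset, ZMod.card, hI]
    have h2 := norm_inner_le_norm (𝕜 := ℂ) (indicatorConstLp 2 (V.measurableSet_sub (k - n))
      (V.measure_sub_lt_top μ (k - n)).ne (1 : ℂ)) F
    rw [L2.inner_indicatorConstLp_one, h1, norm_indicatorConstLp (by norm_num) (by norm_num),
      norm_one, one_mul, real_sub V hμ, norm_mul, norm_pow, Complex.norm_natCast] at h2
    have h3 := pow_le_pow_left₀ (by positivity) h2 2
    rw [mul_pow, mul_pow, ← Real.rpow_natCast (((p : ℝ) ^ (-(k - (n : ℤ)))) ^ _),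
      ← Real.rpow_mul (by positivity)] at h3
    rw [show (1 / ENNReal.toReal 2 * ((2 : ℕ) : ℝ)) = 1 by norm_num, Real.rpow_one,
      neg_sub, sub_eq_add_neg, zpow_add₀ hp0, zpow_natCast] at h3
    have hpn : (0 : ℝ) < (p : ℝ) ^ n := by positivity
    refine le_of_mul_le_mul_left ?_ hpn
    linarith
  by_contra hne
  have hI0 : 0 < ‖I‖ ^ 2 := by positivity
  obtain ⟨n, hn⟩ := pow_unbounded_of_one_lt (‖F‖ ^ 2 * (p : ℝ) ^ (-k) / ‖I‖ ^ 2) hp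
  rw [div_lt_iff₀ hI0] at hn
  exact absurd (hbound n) (not_le.2 hn)

end Operators

/-! ### The spaces V_j and the MRA axioms -/

section GeneratedSpace

variable {p : ℕ} [Fact p.Prime] {G : Type*} [AddCommGroup G] [TopologicalSpace G]
  [IsTopologicalAddGroup G] [MeasurableSpace G] [BorelSpace G] (V : VilenkinStructure p G)
  {μ : Measure G} [μ.IsAddHaarMeasure] (φ : Lp ℂ 2 μ)

theorem H₀_add_mem {x y : G} (hx : x ∈ V.H₀) (hy : y ∈ V.H₀) : x + y ∈ V.H₀ := by
  rw [mem_H₀_iff] at *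
  intro n hn
  rw [digits_add, Pi.add_apply, hx n hn, hy n hn, add_zero]

theorem H₀_sub_mem {x y : G} (hx : x ∈ V.H₀) (hy : y ∈ V.H₀) : x - y ∈ V.H₀ := by
  rw [mem_H₀_iff] at *
  intro n hn
  rw [digits_sub, Pi.sub_apply, hx n hn, hy n hn, sub_zero]

theorem dilation_mem_H₀ {x : G} (hx : x ∈ V.H₀) {j : ℤ} (hj : 0 ≤ j) : V.dilation j x ∈ V.H₀ := by
  rw [mem_H₀_iff] at *
  intro n hn
  rw [digits_dilation, hx _ (by omega)]

theorem exists_mem_H₀_sub_mem (x : G) : ∃ h ∈ V.H₀, x - h ∈ V.sub 0 := by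
  obtain ⟨m, hm⟩ := V.exists_mem_sub x
  have hm' : x ∈ V.sub (-((-m).toNat : ℕ)) := V.sub_anti (by omega) hm
  have h := (V.sub_combo_mem_iff (n := (-m).toNat) hm').2 rfl
  rw [neg_add_cancel] at h
  refine ⟨_, V.mem_H₀_iff.2 fun n hn => ?_, h⟩
  exact V.digits_combo_of_ge _ (by omega)

theorem generatedSpace_le {W : Submodule ℂ (Lp ℂ 2 μ)} (hW : IsClosed (W : Set (Lp ℂ 2 μ))) {j : ℤ}
    (h : ∀ F : Lp ℂ 2 μ, ∀ h ∈ V.H₀, (F =ᵐ[μ] fun x => φ (V.dilation j x - h)) → F ∈ W) :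
    V.generatedSpace μ φ j ≤ W := by
  refine Submodule.topologicalClosure_minimal _ (Submodule.span_le.2 ?_) hW
  rintro F ⟨y, hy, hF⟩
  exact h F y hy hF

theorem isClosed_generatedSpace (j : ℤ) : IsClosed (V.generatedSpace μ φ j : Set (Lp ℂ 2 μ)) :=
  Submodule.isClosed_topologicalClosure _

variable {φ}

theorem mem_generatedSpace {j : ℤ} {F : Lp ℂ 2 μ} {h : G} (hh : h ∈ V.H₀)
    (hF : F =ᵐ[μ] fun x => φ (V.dilation j x - h)) : F ∈ V.generatedSpace μ φ j :=
  Submodule.le_topologicalClosure _ (Submodule.subset_span ⟨h, hh, hF⟩)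

theorem dilationLp_mem {i j : ℤ} {F : Lp ℂ 2 μ} (hF : F ∈ V.generatedSpace μ φ j) :
    V.dilationLp μ i F ∈ V.generatedSpace μ φ (j + i) := by
  have hcl := (V.isClosed_generatedSpace φ (j + i)).preimage (V.dilationLp μ i).continuous
  refine V.generatedSpace_le φ
    (W := (V.generatedSpace μ φ (j + i)).comap (V.dilationLp μ i : Lp ℂ 2 μ →ₗ[ℂ] Lp ℂ 2 μ))
    hcl ?_ hF
  intro F h hh hF
  refine V.mem_generatedSpace hh ?_
  filter_upwards [V.dilationLp_ae μ i F, (V.quasiMeasurePreserving_dilation μ i).ae hF] with x h1 h2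
  exact h1.trans (by rw [h2, dilation_add])

/-- Translating φ(𝒜^j x - h) by y replaces h by 𝒜^j y + h, which is why the condition is on 𝒜^j y.
-/
theorem translateLp_mem {j : ℤ} {y : G} (hy : V.dilation j y ∈ V.H₀) {F : Lp ℂ 2 μ}
    (hF : F ∈ V.generatedSpace μ φ j) : translateLp μ y F ∈ V.generatedSpace μ φ j := by
  have hcl := (V.isClosed_generatedSpace φ j).preimage (translateLp μ y).continuous
  refine V.generatedSpace_le φ
    (W := (V.generatedSpace μ φ j).comap (translateLp μ y).toLinearMap) hcl ?_ hF
  intro F h hh hF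
  refine V.mem_generatedSpace (V.H₀_add_mem hy hh) ?_
  filter_upwards [translateLp_ae μ y F,
    (measurePreserving_sub_right μ y).quasiMeasurePreserving.ae hF] with x h1 h2
  refine h1.trans ?_
  rw [h2, map_sub, sub_sub]

theorem memSubspace_iff {W : Submodule ℂ (Lp ℂ 2 μ)} {f : G → ℂ} :
    MemSubspace μ W f ↔ ∃ F ∈ W, F =ᵐ[μ] f := by
  constructor
  · rintro ⟨hf, h⟩
    exact ⟨_, h, hf.coeFn_toLp⟩
  · rintro ⟨F, hF, h⟩
    have hf := (memLp_congr_ae h).1 (Lp.memLp F)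
    refine ⟨hf, ?_⟩
    have : hf.toLp f = F := Lp.ext (hf.coeFn_toLp.trans h.symm)
    rwa [this]

theorem memSubspace_dilation_iff (n : ℤ) (f : G → ℂ) :
    MemSubspace μ (V.generatedSpace μ φ n) f ↔
      MemSubspace μ (V.generatedSpace μ φ (n + 1)) fun x => f (V.dilation 1 x) := by
  simp only [memSubspace_iff]
  constructor
  · rintro ⟨F, hF, h⟩
    exact ⟨V.dilationLp μ 1 F, V.dilationLp_mem hF,
      (V.dilationLp_ae μ 1 F).trans ((V.quasiMeasurePreserving_dilation μ 1).ae h)⟩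
  · rintro ⟨F, hF, h⟩
    have h1 := V.dilationLp_mem (i := -1) hF
    rw [add_neg_cancel_right] at h1
    refine ⟨_, h1, ?_⟩
    filter_upwards [V.dilationLp_ae μ (-1) F,
      (V.quasiMeasurePreserving_dilation μ (-1)).ae h] with x h1 h2
    rw [h1, h2, dilation_dilation_neg]

theorem memSubspace_shift {f : G → ℂ} (hf : MemSubspace μ (V.generatedSpace μ φ 0) f) {h : G}
    (hh : h ∈ V.H₀) : MemSubspace μ (V.generatedSpace μ φ 0) fun x => f (x - h) := by
  rw [memSubspace_iff] at *
  obtain ⟨F, hF, hFf⟩ := hf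
  exact ⟨_, V.translateLp_mem (by rwa [dilation_zero]) hF, (translateLp_ae μ h F).trans
    ((measurePreserving_sub_right μ h).quasiMeasurePreserving.ae hFf)⟩

/-- The refinement relation `φ ∈ V_1` implies that the spaces `V_n` are nested. -/
theorem generatedSpace_le_succ (hφ : φ ∈ V.generatedSpace μ φ 1) (n : ℤ) :
    V.generatedSpace μ φ n ≤ V.generatedSpace μ φ (n + 1) := by
  refine V.generatedSpace_le φ (V.isClosed_generatedSpace φ _) fun F h hh hF => ?_
  -- V_1 is invariant under translation by H₀ because 𝒜 maps H₀ into itself.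
  have h0 : translateLp μ h φ ∈ V.generatedSpace μ φ 1 :=
    V.translateLp_mem (V.dilation_mem_H₀ hh (by norm_num)) hφ
  have h1 := V.dilationLp_mem (i := n) h0
  rw [add_comm] at h1
  convert h1 using 1
  refine Lp.ext ?_
  filter_upwards [hF, V.dilationLp_ae μ n (translateLp μ h φ),
    (V.quasiMeasurePreserving_dilation μ n).ae (translateLp_ae μ h φ)] with x h1 h2 h3
  rw [h1, h2, h3]

/-- If `φ` is constant on the cosets of some `G_M`, then the spaces `V_n` intersect trivially. -/
theorem iInf_generatedSpace (hμ : μ (V.sub 0 : Set G) = 1) {M : ℤ} {f : G → ℂ}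
    (hφ : φ =ᵐ[μ] f) (hf : ∀ x, ∀ y ∈ V.sub M, f (x + y) = f x) :
    ⨅ n, V.generatedSpace μ φ n = ⊥ := by
  rw [eq_bot_iff]
  intro F hF
  rw [Submodule.mem_iInf] at hF
  refine V.eq_zero_of_forall_translateLp_eq hμ fun y => ?_
  obtain ⟨k, hk⟩ := V.exists_mem_sub y
  -- The level k - M is chosen so that every generator of that space is invariant under G_k, which
  -- contains y.
  have hy : V.dilation (k - M) y ∈ V.sub M := (V.dilation_mem_iff _ _ _).2 (by simpa using hk)
  refine V.generatedSpace_le φ (j := k - M)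
    (W := LinearMap.eqLocus (translateLp μ y).toLinearMap LinearMap.id)
    (isClosed_eq (translateLp μ y).continuous continuous_id) ?_ (hF (k - M))
  intro F h hh hF
  refine Lp.ext ((translateLp_ae μ y F).trans ?_)
  have hF' : F =ᵐ[μ] fun x => f (V.dilation (k - M) x - h) :=
    hF.trans ((V.quasiMeasurePreserving_dilation_sub μ (k - M) h).ae hφ)
  filter_upwards [hF', (measurePreserving_sub_right μ y).quasiMeasurePreserving.ae hF']
    with x h1 h2
  rw [h2, LinearMap.id_apply, h1, map_sub, ← hf _ _ hy]
  congr 1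
  abel

/-- If the shifts of `φ` form a partition of unity on `G_m`, then the union of the spaces `V_n`
is dense. -/
theorem dense_iUnion_generatedSpace (hmono : Monotone (V.generatedSpace μ φ)) {m : ℤ} (hm : m ≤ 0)
    {f : G → ℂ} (hφ : φ =ᵐ[μ] f) {ι : Type*} [Fintype ι] (b : ι → G) (hb : ∀ i, b i ∈ V.H₀)
    (hf : ∀ x, ∑ i, f (x - b i) = (V.sub m : Set G).indicator 1 x) :
    Dense (⋃ n, (V.generatedSpace μ φ n : Set (Lp ℂ 2 μ))) := by
  have hdir : Directed (· ≤ ·) (V.generatedSpace μ φ) := hmono.directed_le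
  rw [← Submodule.coe_iSup_of_directed _ hdir, Submodule.dense_iff_topologicalClosure_eq_top,
    Submodule.topologicalClosure_eq_top_iff, eq_bot_iff]
  intro F hF
  rw [Submodule.mem_orthogonal] at hF
  refine Lp.ext (.trans (V.ae_eq_zero_of_setIntegral_coset
    (memLp_locallyIntegrable V (Lp.memLp F)) fun y k => ?_) (Lp.coeFn_zero _ _ _).symm)
  have hfin : μ (V.coset y k) ≠ ∞ := by
    rw [measure_coset]
    exact (V.measure_sub_lt_top μ k).ne
  rw [← L2.inner_indicatorConstLp_one (𝕜 := ℂ) (V.measurableSet_coset y k) hfin]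
  -- 𝒜^{k-m} carries G_k onto G_m, so at this level the partition of unity becomes one on cosets of
  -- G_k.
  refine hF _ (Submodule.mem_iSup_of_mem (k - m) ?_)
  -- The centre 𝒜^{k-m} y may be replaced by a point of H₀ because they differ by an element of G_0
  -- ⊂ G_m; this uses m ≤ 0.
  obtain ⟨h, hh, hyh⟩ := V.exists_mem_H₀_sub_mem (V.dilation (k - m) y)
  have hsum : indicatorConstLp 2 (V.measurableSet_coset y k) hfin (1 : ℂ) =
      ∑ i, V.dilationLp μ (k - m) (translateLp μ (h + b i) φ) := by
    refine Lp.ext ?_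
    have h1 : ∀ i, V.dilationLp μ (k - m) (translateLp μ (h + b i) φ) =ᵐ[μ]
        fun x => f (V.dilation (k - m) x - h - b i) := by
      intro i
      filter_upwards [V.dilationLp_ae μ (k - m) (translateLp μ (h + b i) φ),
        (V.quasiMeasurePreserving_dilation μ (k - m)).ae (translateLp_ae μ (h + b i) φ),
        (V.quasiMeasurePreserving_dilation_sub μ (k - m) (h + b i)).ae hφ] with x h1 h2 h3
      rw [h1, h2, h3, sub_sub]
    filter_upwards [indicatorConstLp_coeFn (p := 2) (hs := V.measurableSet_coset y k) (hμs := hfin)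
        (c := (1 : ℂ)),
      Lp.coeFn_finsetSum Finset.univ fun i =>
        V.dilationLp μ (k - m) (translateLp μ (h + b i) φ), ae_all_iff.2 h1] with x h1 h2 h3
    rw [h1, h2, Finset.sum_apply, Finset.sum_congr rfl fun i _ => h3 i, hf]
    have hiff : x ∈ V.coset y k ↔ V.dilation (k - m) x - h ∈ (V.sub m : Set G) := by
      have h4 : V.dilation (k - m) x - h =
          V.dilation (k - m) (x - y) + (V.dilation (k - m) y - h) := by rw [map_sub]; abel
      rw [mem_coset, h4, SetLike.mem_coe, (V.sub m).add_mem_cancel_right (V.sub_anti hm hyh),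
        dilation_mem_iff, add_sub_cancel]
    by_cases hx : x ∈ V.coset y k
    · rw [Set.indicator_of_mem hx, Set.indicator_of_mem (hiff.1 hx), Pi.one_apply]
    · rw [Set.indicator_of_notMem hx, Set.indicator_of_notMem (fun h => hx (hiff.2 h))]
  rw [hsum]
  refine Submodule.sum_mem _ fun i _ => ?_
  have h0 : translateLp μ (h + b i) φ ∈ V.generatedSpace μ φ 0 := by
    refine V.mem_generatedSpace (V.H₀_add_mem hh (hb i)) ?_
    simpa only [dilation_zero] using translateLp_ae μ (h + b i) φ
  have := V.dilationLp_mem (i := k - m) h0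
  rwa [zero_add] at this

end GeneratedSpace

/-! ### The infinite product of dilated masks -/

section MaskProduct

variable {p : ℕ} [Fact p.Prime] {G : Type*} [AddCommGroup G] [TopologicalSpace G]
  [IsTopologicalAddGroup G] (V : VilenkinStructure p G)

/-- The infinite product `∏_{n ≥ 0} m₀(χ𝒜^{-n})`. -/
noncomputable def maskProduct (m₀ : Characters G → ℂ) (χ : Characters G) : ℂ :=
  ∏' n : ℕ, m₀ (V.charDilation (-n) χ)

variable {m₀ : Characters G → ℂ} {N : ℕ}

theorem maskProduct_eq_prod (h1 : ∀ χ ∈ V.annihilator (-N), m₀ χ = 1) {χ : Characters G} {K : ℕ}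
    (hχ : χ ∈ V.annihilator (K - N)) :
    V.maskProduct m₀ χ = ∏ n ∈ Finset.range K, m₀ (V.charDilation (-n) χ) := by
  refine tprod_eq_prod fun n hn => h1 _ ?_
  rw [Finset.mem_range, not_lt] at hn
  rw [charDilation_mem_iff]
  exact V.annihilator_mono (by omega) hχ

theorem maskProduct_eq_one (h1 : ∀ χ ∈ V.annihilator (-N), m₀ χ = 1) {χ : Characters G}
    (hχ : χ ∈ V.annihilator (-N)) : V.maskProduct m₀ χ = 1 := by
  rw [V.maskProduct_eq_prod h1 (K := 0) (by simpa using hχ)]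
  simp

theorem maskProduct_refinement (h1 : ∀ χ ∈ V.annihilator (-N), m₀ χ = 1) (χ : Characters G) :
    V.maskProduct m₀ χ = m₀ χ * V.maskProduct m₀ (V.charDilation (-1) χ) := by
  obtain ⟨k, hk⟩ := V.exists_mem_annihilator χ
  have hχ : χ ∈ V.annihilator (((k + N).toNat + 1 : ℕ) - N) :=
    V.annihilator_mono (by omega) hk
  have hχ' : V.charDilation (-1) χ ∈ V.annihilator ((k + N).toNat - N) := by
    rw [charDilation_mem_iff]
    exact V.annihilator_mono (by omega) hk
  rw [V.maskProduct_eq_prod h1 hχ, V.maskProduct_eq_prod h1 hχ', Finset.prod_range_succ', mul_comm]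
  congr 1
  · simp [charDilation_zero]
  · refine Finset.prod_congr rfl fun n _ => ?_
    rw [charDilation_charDilation]
    congr 2
    push_cast
    ring

/-- For n ≥ 0, χ ↦ χ𝒜^{-n} maps G_{-N}^⊥ into itself, so each factor is invariant. -/
theorem maskProduct_mul (h : ∀ χ ∈ V.annihilator (-N), ∀ ζ, m₀ (χ * ζ) = m₀ ζ) (χ : Characters G)
    {ζ : Characters G} (hζ : ζ ∈ V.annihilator (-N)) :
    V.maskProduct m₀ (χ * ζ) = V.maskProduct m₀ χ := by
  refine tprod_congr fun n => ?_
  rw [charDilation_mul, mul_comm]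
  refine h _ ?_ _
  rw [charDilation_mem_iff]
  exact V.annihilator_mono (by omega) hζ

/-- If χ lies in the shell G_{M+k+1}^⊥ \ G_{M+k}^⊥, then χ𝒜^{-k} lies in the shell where the finite
product vanishes. Its zero factor, of index n, is the factor of index k + n in the product at χ. -/
theorem maskProduct_eq_zero {M : ℕ} (h1 : ∀ χ ∈ V.annihilator (-N), m₀ χ = 1)
    (h0 : ∀ χ ∈ V.annihilator (M + 1), χ ∉ V.annihilator M →
      ∏ n ∈ Finset.range (M + N + 1), m₀ (V.charDilation (-n) χ) = 0) {χ : Characters G}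
    (hχ : χ ∉ V.annihilator M) : V.maskProduct m₀ χ = 0 := by
  classical
  have hex : ∃ K : ℕ, χ ∈ V.annihilator (M + K) := by
    obtain ⟨k, hk⟩ := V.exists_mem_annihilator χ
    exact ⟨k.toNat, V.annihilator_mono (by omega) hk⟩
  obtain ⟨k, hk⟩ : ∃ k, Nat.find hex = k + 1 := by
    refine Nat.exists_eq_succ_of_ne_zero fun h => hχ ?_
    have := Nat.find_spec hex
    rw [h] at this
    simpa using this
  have hmem := Nat.find_spec hex
  have hnot := Nat.find_min hex (m := k) (by omega)
  rw [hk] at hmem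
  have h2 := h0 (V.charDilation (-k) χ)
    ((V.charDilation_mem_iff _ _ _).2 (V.annihilator_mono (by push_cast; omega) hmem))
    (fun h => hnot (by
      rw [charDilation_mem_iff] at h
      exact V.annihilator_mono (by omega) h))
  obtain ⟨n, hn, hn0⟩ := Finset.prod_eq_zero_iff.1 h2
  rw [Finset.mem_range] at hn
  rw [V.maskProduct_eq_prod h1 (K := M + N + 1 + k)
    (V.annihilator_mono (by push_cast; omega) hmem)]
  refine Finset.prod_eq_zero (i := k + n) (Finset.mem_range.2 (by omega)) ?_
  rw [charDilation_charDilation] at hn0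
  rw [← hn0]
  congr 2
  push_cast
  ring

end MaskProduct

/-! ### Splitting Rademacher products into blocks -/

section RadFactorization

variable {p : ℕ} [Fact p.Prime] {G : Type*} [AddCommGroup G] [TopologicalSpace G]
  [IsTopologicalAddGroup G] (V : VilenkinStructure p G)

theorem rad_append (m : ℤ) (k n : ℕ) (a : Fin k → ZMod p) (b : Fin n → ZMod p) :
    V.rad m (k + n) (Fin.append a b) = V.rad m k a * V.rad (m + k) n b := by
  rw [rad, Fin.prod_univ_add]
  congr 1
  · simp [rad]
  · simp [rad, add_assoc]

theorem sum_append {k n : ℕ} (f : (Fin (k + n) → ZMod p) → ℂ) :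
    ∑ a, f a = ∑ b : Fin k → ZMod p, ∑ c : Fin n → ZMod p, f (Fin.append b c) := by
  rw [← Fintype.sum_prod_type', ← (Fin.appendEquiv k n).sum_comp]
  rfl

theorem pairing_rad_eq_one {m : ℤ} {n : ℕ} (a : Fin n → ZMod p) {x : G}
    (hx : ∀ k, m ≤ k → V.digits x k = 0) : pairing (V.rad m n a) x = 1 := by
  rw [pairing_rad, Finset.sum_eq_zero, AddChar.map_zero_eq_one]
  intro j _
  rw [hx _ (by omega), mul_zero]

theorem pairing_rad_sub (m : ℤ) (n : ℕ) (a b : Fin n → ZMod p) (x : G) :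
    pairing (V.rad m n (a - b)) x = pairing (V.rad m n a) x * (pairing (V.rad m n b) x)⁻¹ := by
  simp only [pairing_rad, Pi.sub_apply, sub_mul, Finset.sum_sub_distrib]
  rw [AddChar.map_sub_eq_div, div_eq_mul_inv]

/-- The residues modulo `p` as digits. -/
def zmodEquivFin (p : ℕ) [NeZero p] : ZMod p ≃ Fin p where
  toFun c := ⟨c.val, ZMod.val_lt c⟩
  invFun i := (i : ℕ)
  left_inv c := by simp
  right_inv i := Fin.ext (ZMod.val_natCast_of_lt i.2)

end RadFactorization

/-! ### The scaling function as an explicit finite sum -/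

section InverseTransform

variable {p : ℕ} [Fact p.Prime] {G : Type*} [AddCommGroup G] [TopologicalSpace G]
  [IsTopologicalAddGroup G] (V : VilenkinStructure p G)

/-- The inverse Fourier transform of a function supported in `G_{m + n}^⊥` and constant on the
cosets of `G_m^⊥`. -/
noncomputable def inverseTransform (Φ : Characters G → ℂ) (m : ℤ) (n : ℕ) : G → ℂ :=
  (V.sub m : Set G).indicator fun x =>
    (p : ℂ) ^ m * ∑ a, Φ (V.rad m n a) * pairing (V.rad m n a) x

variable {Φ : Characters G → ℂ} {m : ℤ} {n : ℕ}

theorem inverseTransform_of_mem {x : G} (hx : x ∈ V.sub m) : V.inverseTransform Φ m n x =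
    (p : ℂ) ^ m * ∑ a, Φ (V.rad m n a) * pairing (V.rad m n a) x :=
  Set.indicator_of_mem (SetLike.mem_coe.2 hx) _

theorem inverseTransform_of_notMem {x : G} (hx : x ∉ V.sub m) : V.inverseTransform Φ m n x = 0 :=
  Set.indicator_of_notMem (fun h => hx h) _

theorem inverseTransform_add (x : G) {y : G} (hy : y ∈ V.sub (m + n)) :
    V.inverseTransform Φ m n (x + y) = V.inverseTransform Φ m n x := by
  have hiff : x + y ∈ V.sub m ↔ x ∈ V.sub m :=
    (V.sub m).add_mem_cancel_right (V.sub_anti (by omega) hy)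
  by_cases hx : x ∈ V.sub m
  · rw [inverseTransform_of_mem _ hx, inverseTransform_of_mem _ (hiff.2 hx)]
    congr 1
    refine Finset.sum_congr rfl fun a _ => ?_
    rw [pairing_add, V.rad_mem_annihilator m n a y hy, mul_one]
  · rw [inverseTransform_of_notMem _ hx, inverseTransform_of_notMem _ fun h => hx (hiff.1 h)]

variable [MeasurableSpace G] [BorelSpace G] {μ : Measure G} [μ.IsAddHaarMeasure]

theorem memLp_inverseTransform : MemLp (V.inverseTransform Φ m n) 2 μ :=
  (V.continuous_of_add_eq fun x _ hy => V.inverseTransform_add x hy).memLp_of_hasCompactSupport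
    (V.hasCompactSupport_of_sub fun _ hx => V.inverseTransform_of_notMem hx)

theorem integrableOn_memLp {f : G → ℂ} (hf : MemLp f 2 μ) (k : ℤ) : IntegrableOn f (V.sub k) μ :=
  (memLp_locallyIntegrable V hf).integrableOn_isCompact (V.isCompact_sub k)

/-- The truncated Fourier transform of a function supported in `G_m`. -/
theorem truncFourier_eq_integral [MeasurableSpace (Characters G)] [BorelSpace (Characters G)]
    {f : G → ℂ} (hf : ∀ x, x ∉ V.sub m → f x = 0) (χ : Characters G) :
    V.truncFourier μ f m χ = ∫ x, f x * conj (pairing χ x) ∂μ :=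
  setIntegral_eq_integral_of_forall_compl_eq_zero fun x hx => by
    rw [hf x hx, zero_mul]

theorem integral_translate_mul_pairing (f : G → ℂ) (y : G) (χ : Characters G) :
    ∫ x, f (x - y) * conj (pairing χ x) ∂μ =
      conj (pairing χ y) * ∫ x, f x * conj (pairing χ x) ∂μ := by
  rw [← integral_add_right_eq_self _ y, ← integral_const_mul]
  congr 1
  funext x
  rw [add_sub_cancel_right, pairing_add, map_mul]
  ring

/-- Integrating a character over G_m keeps only the representative `rad m n a` in the coset of χ
modulo G_m^⊥; the factor p^m cancels μ(G_m) = p^{-m}. -/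
theorem truncFourier_inverseTransform [MeasurableSpace (Characters G)]
    [BorelSpace (Characters G)] (hμ : μ (V.sub 0 : Set G) = 1)
    (hinv : ∀ χ, ∀ ζ ∈ V.annihilator m, Φ (χ * ζ) = Φ χ)
    (hsupp : ∀ χ, χ ∉ V.annihilator (m + n) → Φ χ = 0) (χ : Characters G) :
    V.truncFourier μ (V.inverseTransform Φ m n) m χ = Φ χ := by
  classical
  have := V.t2Space
  have hp : (p : ℂ) ≠ 0 := by exact_mod_cast (Fact.out : p.Prime).ne_zero
  have h1 : V.truncFourier μ (V.inverseTransform Φ m n) m χ = ∫ x in (V.sub m : Set G),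
      ∑ a, ((p : ℂ) ^ m * Φ (V.rad m n a)) * pairing (V.rad m n a * χ⁻¹) x ∂μ := by
    refine setIntegral_congr_fun (V.measurableSet_sub m) fun x hx => ?_
    simp only [V.inverseTransform_of_mem hx, Finset.mul_sum, Finset.sum_mul]
    refine Finset.sum_congr rfl fun a _ => ?_
    rw [pairing_mul, pairing_inv, conj_pairing]
    ring
  rw [h1, integral_finsetSum]
  · simp only [integral_const_mul, setIntegral_pairing, real_sub V hμ]
    by_cases hχ : χ ∈ V.annihilator (m + n)
    · obtain ⟨a, ha⟩ := V.exists_mul_inv_rad_mem hχ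
      rw [Finset.sum_eq_single a]
      · have h2 : V.rad m n a * χ⁻¹ ∈ V.annihilator m := by
          have := inv_mem ha
          rwa [mul_inv_rev, inv_inv] at this
        have h3 : Φ χ = Φ (V.rad m n a) := by
          rw [← hinv (V.rad m n a) _ ha, mul_comm χ, mul_inv_cancel_left]
        rw [if_pos h2, h3]
        push_cast
        rw [zpow_neg]
        field_simp
      · intro b _ hb
        rw [if_neg, mul_zero]
        intro h
        refine hb (V.rad_mul_inv_rad_mem (m := m) ?_)
        have := mul_mem h ha
        rwa [mul_assoc, inv_mul_cancel_left] at this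
      · simp
    · rw [hsupp χ hχ]
      refine Finset.sum_eq_zero fun a _ => ?_
      rw [if_neg, mul_zero]
      intro h
      refine hχ ?_
      have := mul_mem (inv_mem (V.annihilator_mono (by omega) h)) (V.rad_mem_annihilator m n a)
      rwa [mul_inv_rev, inv_inv, inv_mul_cancel_right] at this
  · intro a _
    exact ((continuous_pairing _).continuousOn.integrableOn_compact (V.isCompact_sub m)).const_mul _

theorem memLp_of_support [MeasurableSpace (Characters G)]
    [BorelSpace (Characters G)] {ν : Measure (Characters G)} [ν.IsHaarMeasure]
    (hν : ν (V.annihilator 0 : Set (Characters G)) = 1)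
    (hinv : ∀ χ, ∀ ζ ∈ V.annihilator m, Φ (χ * ζ) = Φ χ)
    (hsupp : ∀ χ, χ ∉ V.annihilator (m + n) → Φ χ = 0) : MemLp Φ 2 ν := by
  have hcont := V.continuous_of_mul_eq hinv
  have hind : (V.annihilator (m + n) : Set (Characters G)).indicator Φ = Φ :=
    Set.indicator_eq_self.2 fun χ hχ => by
      by_contra h
      exact hχ (hsupp χ h)
  rw [← hind, memLp_indicator_iff_restrict (V.measurableSet_annihilator _)]
  have : IsFiniteMeasure (ν.restrict (V.annihilator (m + n) : Set (Characters G))) :=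
    ⟨by rw [Measure.restrict_apply_univ]; exact V.measure_annihilator_lt_top hν _⟩
  refine MemLp.of_bound hcont.aestronglyMeasurable (∑ a, ‖Φ (V.rad m n a)‖) ?_
  filter_upwards [ae_restrict_mem (V.measurableSet_annihilator _)] with χ hχ
  obtain ⟨a, ha⟩ := V.exists_mul_inv_rad_mem hχ
  have h3 : Φ χ = Φ (V.rad m n a) := by
    rw [← hinv (V.rad m n a) _ ha, mul_comm χ, mul_inv_cancel_left]
  rw [h3]
  exact Finset.single_le_sum (f := fun a => ‖Φ (V.rad m n a)‖) (fun _ _ => norm_nonneg _)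
    (Finset.mem_univ a)

end InverseTransform

/-! ### Orthonormal shifts and partition of unity -/

section Orthonormality

variable {p : ℕ} [Fact p.Prime] {G : Type*} [AddCommGroup G] [TopologicalSpace G]
  [IsTopologicalAddGroup G] [MeasurableSpace G] [BorelSpace G] (V : VilenkinStructure p G)
  [MeasurableSpace (Characters G)] [BorelSpace (Characters G)]
  {μ : Measure G} [μ.IsAddHaarMeasure] {Φ : Characters G → ℂ} {M N : ℕ}

theorem pairing_rad_append (b : Fin N → ZMod p) (a : Fin M → ZMod p) {x : G}
    (hx : ∀ k, 0 ≤ k → V.digits x k = 0) :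
    pairing (V.rad (-N) (N + M) (Fin.append b a)) x = pairing (V.rad (-N) N b) x := by
  rw [rad_append, pairing_mul, neg_add_cancel, V.pairing_rad_eq_one a hx, mul_one]

/-- Expanding the conjugated factor gives p^{-N} ∑ₐ conj (rad a, δ) |Φ(rad a)|². As δ has no digits
of index ≥ 0, the character depends only on the block r_{-N}, …, r_{-1}; the other block sums to 1
by `horth`. What is left is a character sum over G_{-N} / G_0, and H₀ meets G_0 only in 0. -/
theorem integral_inverseTransform_translate (hμ : μ (V.sub 0 : Set G) = 1)
    (hinv : ∀ χ, ∀ ζ ∈ V.annihilator (-N), Φ (χ * ζ) = Φ χ)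
    (hsupp : ∀ χ, χ ∉ V.annihilator M → Φ χ = 0)
    (horth : ∀ b : Fin N → ZMod p, ∑ a : Fin M → ZMod p,
      ‖Φ (V.rad (-N) N b * V.rad 0 M a)‖ ^ 2 = 1) {δ : G} (hδ : δ ∈ V.H₀) [Decidable (δ = 0)] :
    ∫ x, V.inverseTransform Φ (-N) (N + M) (x - δ) *
      conj (V.inverseTransform Φ (-N) (N + M) x) ∂μ = if δ = 0 then 1 else 0 := by
  classical
  set f := V.inverseTransform Φ (-N) (N + M) with hf
  have hp : (p : ℂ) ≠ 0 := by exact_mod_cast (Fact.out : p.Prime).ne_zero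
  have hfs : ∀ x, x ∉ V.sub (-N) → f x = 0 := fun x hx => V.inverseTransform_of_notMem hx
  have hfm : MemLp f 2 μ := V.memLp_inverseTransform
  have hNM : (-N + (N + M : ℕ) : ℤ) = M := by push_cast; ring
  by_cases hmem : δ ∈ V.sub (-N)
  · have hδ' := V.mem_H₀_iff.1 hδ
    have hFT : ∀ χ, ∫ x in (V.sub (-N) : Set G), f (x - δ) * conj (pairing χ x) ∂μ =
        conj (pairing χ δ) * Φ χ := by
      intro χ
      rw [← V.truncFourier_inverseTransform (n := N + M) hμ hinv (by rwa [hNM]) χ,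
        V.truncFourier_eq_integral hfs, ← integral_translate_mul_pairing]
      refine setIntegral_eq_integral_of_forall_compl_eq_zero fun x hx => ?_
      rw [hfs, zero_mul]
      intro h
      have := (V.sub (-N)).add_mem h hmem
      rw [sub_add_cancel] at this
      exact hx this
    have hint : ∀ χ, IntegrableOn (fun x => f (x - δ) * conj (pairing χ x)) (V.sub (-N)) μ :=
      fun χ => integrableOn_mul_pairing (V.integrableOn_memLp
        (hfm.comp_measurePreserving (measurePreserving_sub_right μ δ)) _) χ
    have h1 : ∫ x, f (x - δ) * conj (f x) ∂μ = ∫ x in (V.sub (-N) : Set G),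
        ∑ a, ((p : ℂ) ^ (-N : ℤ) * conj (Φ (V.rad (-N) (N + M) a))) *
          (f (x - δ) * conj (pairing (V.rad (-N) (N + M) a) x)) ∂μ := by
      rw [← setIntegral_eq_integral_of_forall_compl_eq_zero (s := (V.sub (-N) : Set G))
        fun x hx => by rw [hfs x hx, map_zero, mul_zero]]
      refine setIntegral_congr_fun (V.measurableSet_sub _) fun x hx => ?_
      simp only [hf]
      rw [V.inverseTransform_of_mem (x := x) hx]
      simp only [map_mul, map_sum, map_zpow₀, Complex.conj_natCast, Finset.mul_sum]
      exact Finset.sum_congr rfl fun a _ => by ring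
    rw [h1, integral_finsetSum _ fun a _ => (hint _).const_mul _]
    simp only [integral_const_mul, hFT]
    have h2 : ∀ a, (p : ℂ) ^ (-N : ℤ) * conj (Φ (V.rad (-N) (N + M) a)) *
        (conj (pairing (V.rad (-N) (N + M) a) δ) * Φ (V.rad (-N) (N + M) a)) =
        (p : ℂ) ^ (-N : ℤ) * conj (pairing (V.rad (-N) (N + M) a) δ) *
          ((‖Φ (V.rad (-N) (N + M) a)‖ ^ 2 : ℝ) : ℂ) := by
      intro a
      rw [Complex.ofReal_pow, ← Complex.conj_mul']
      ring
    simp only [h2]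
    rw [sum_append]
    simp only [V.pairing_rad_append _ _ hδ']
    simp only [rad_append, neg_add_cancel, ← Finset.mul_sum, ← Complex.ofReal_sum, horth,
      Complex.ofReal_one, mul_one, ← map_sum]
    rw [V.sum_pairing_rad hmem, neg_add_cancel]
    have h3 : δ ∈ V.sub 0 ↔ δ = 0 := by
      refine ⟨fun h => V.eq_of_digits_eq (funext fun k => ?_), fun h => h ▸ zero_mem _⟩
      rw [digits_zero, Pi.zero_apply]
      rcases lt_or_ge k 0 with hk | hk
      · exact (V.mem_sub_iff_digits _ _).1 h k hk
      · exact hδ' k hk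
    simp only [h3]
    split_ifs
    · rw [map_pow, Complex.conj_natCast, zpow_neg, zpow_natCast, inv_mul_cancel₀ (pow_ne_zero _ hp)]
    · simp
  -- When δ is outside G_{-N} the supports of the two factors are disjoint.
  · rw [if_neg (fun h : δ = 0 => hmem (by rw [h]; exact zero_mem _))]
    refine integral_eq_zero_of_ae (Eventually.of_forall fun x => ?_)
    by_cases hx : x ∈ V.sub (-N)
    · have : x - δ ∉ V.sub (-N) := fun h => hmem (by
        have := (V.sub (-N)).sub_mem hx h
        rwa [sub_sub_cancel] at this)
      simp [hfs _ this]
    · simp [hfs _ hx]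

theorem orthonormal_translateLp (hμ : μ (V.sub 0 : Set G) = 1)
    (hinv : ∀ χ, ∀ ζ ∈ V.annihilator (-N), Φ (χ * ζ) = Φ χ)
    (hsupp : ∀ χ, χ ∉ V.annihilator M → Φ χ = 0)
    (horth : ∀ b : Fin N → ZMod p, ∑ a : Fin M → ZMod p,
      ‖Φ (V.rad (-N) N b * V.rad 0 M a)‖ ^ 2 = 1) {φ : Lp ℂ 2 μ}
    (hφ : φ =ᵐ[μ] V.inverseTransform Φ (-N) (N + M)) :
    Orthonormal ℂ fun h : V.H₀ => translateLp μ (h : G) φ := by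
  classical
  rw [orthonormal_iff_ite]
  intro h h'
  have hsub : (h' : G) - h = 0 ↔ h = h' := by rw [sub_eq_zero, Subtype.ext_iff, eq_comm]
  have h1 := V.integral_inverseTransform_translate hμ hinv hsupp horth (V.H₀_sub_mem h'.2 h.2)
  simp only [hsub] at h1
  rw [← h1, L2.inner_def, ← integral_sub_right_eq_self (fun x => V.inverseTransform Φ (-N) (N + M)
    (x - (h' - h)) * conj (V.inverseTransform Φ (-N) (N + M) x)) (h : G)]
  refine integral_congr_ae ?_
  have hae : ∀ y : G, translateLp μ y φ =ᵐ[μ]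
      fun x => V.inverseTransform Φ (-N) (N + M) (x - y) := fun y =>
    (translateLp_ae μ y φ).trans ((measurePreserving_sub_right μ y).quasiMeasurePreserving.ae hφ)
  filter_upwards [hae h, hae h'] with x h2 h3
  rw [h2, h3, RCLike.inner_apply, sub_sub, add_sub_cancel]

/-- The shifts of the scaling function form a partition of unity. -/
theorem sum_inverseTransform_translate (hone : Φ 1 = 1)
    (horth : ∀ b : Fin N → ZMod p, ∑ a : Fin M → ZMod p,
      ‖Φ (V.rad (-N) N b * V.rad 0 M a)‖ ^ 2 = 1) (x : G) :
    ∑ b, V.inverseTransform Φ (-N) (N + M) (x - V.combo (-N) N b) =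
      (V.sub (-N) : Set G).indicator 1 x := by
  classical
  have hp : (p : ℂ) ≠ 0 := by exact_mod_cast (Fact.out : p.Prime).ne_zero
  have hiff : ∀ b, x - V.combo (-N) N b ∈ V.sub (-N) ↔ x ∈ V.sub (-N) := fun b => by
    rw [sub_eq_add_neg]
    exact (V.sub _).add_mem_cancel_right (neg_mem (V.combo_mem _ _ _))
  by_cases hx : x ∈ V.sub (-N)
  · rw [Set.indicator_of_mem (SetLike.mem_coe.2 hx), Pi.one_apply]
    simp only [V.inverseTransform_of_mem ((hiff _).2 hx), pairing_sub]
    rw [← Finset.mul_sum, Finset.sum_comm, sum_append]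
    have hd : ∀ (b : Fin N → ZMod p) (k : ℤ), 0 ≤ k → V.digits (V.combo (-N) N b) k = 0 :=
      fun b k hk => V.digits_combo_of_ge b (by omega)
    -- Summing over the shifts kills every character whose block r_{-N}, …, r_{-1} is nontrivial.
    simp only [V.pairing_rad_append _ _ (hd _), ← conj_pairing, ← mul_assoc, ← Finset.mul_sum,
      ← map_sum, sum_pairing_combo]
    rw [Finset.sum_eq_single 0]
    -- In `horth 0` the term a = 0 is |Φ(1)|² = 1, so it exhausts the sum.
    · have hz : ∀ a : Fin M → ZMod p, a ≠ 0 → Φ (V.rad 0 M a) = 0 := by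
        intro a ha
        have h0 := horth 0
        simp only [rad_zero, one_mul] at h0
        rw [← Finset.add_sum_erase _ _ (Finset.mem_univ (0 : Fin M → ZMod p)), rad_zero, hone,
          norm_one, one_pow, add_eq_left, Finset.sum_eq_zero_iff_of_nonneg
            fun _ _ => by positivity] at h0
        simpa using h0 a (Finset.mem_erase.2 ⟨ha, Finset.mem_univ _⟩)
      rw [Finset.sum_eq_single 0]
      · simp only [rad_append, rad_zero, mul_one, hone, pairing_one, if_true, map_pow,
          Complex.conj_natCast, one_mul]
        rw [zpow_neg, zpow_natCast, inv_mul_cancel₀ (pow_ne_zero _ hp)]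
      · intro a _ ha
        rw [rad_append, rad_zero, one_mul, neg_add_cancel, hz a ha, zero_mul, zero_mul]
      · simp
    · intro b _ hb
      simp [hb]
    · simp
  · rw [Set.indicator_of_notMem (fun h => hx h)]
    exact Finset.sum_eq_zero fun b _ => V.inverseTransform_of_notMem fun h => hx ((hiff b).1 h)

end Orthonormality

/-! ### The refinement equation -/

section Refinement

variable {p : ℕ} [Fact p.Prime] {G : Type*} [AddCommGroup G] [TopologicalSpace G]
  [IsTopologicalAddGroup G] (V : VilenkinStructure p G) {m₀ : Characters G → ℂ} {N : ℕ}

/-- The Fourier coefficients of the mask. -/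
noncomputable def maskCoeff (m₀ : Characters G → ℂ) (N : ℕ) (b : Fin (N + 1) → ZMod p) : ℂ :=
  ((p : ℂ) ^ (N + 1))⁻¹ * ∑ a, m₀ (V.rad (-N) (N + 1) a) *
    pairing (V.rad (-N) (N + 1) a) (V.combo (-N) (N + 1) b)

/-- The mask is a trigonometric polynomial. -/
theorem sum_maskCoeff (h1 : ∀ χ ∈ V.annihilator (-N), ∀ ζ, m₀ (χ * ζ) = m₀ ζ)
    (h2 : ∀ (s : ℕ) (a : Fin s → ZMod p) (χ : Characters G), m₀ (χ * V.rad 1 s a) = m₀ χ)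
    (χ : Characters G) :
    ∑ b, V.maskCoeff m₀ N b * conj (pairing χ (V.combo (-N) (N + 1) b)) = m₀ χ := by
  classical
  have hp : (p : ℂ) ≠ 0 := by exact_mod_cast (Fact.out : p.Prime).ne_zero
  have hN1 : (-N + (N + 1 : ℕ) : ℤ) = 1 := by push_cast; ring
  obtain ⟨k, hk⟩ := V.exists_mem_annihilator χ
  have hk' : χ ∈ V.annihilator (-N + (N + 1 + k.toNat : ℕ)) :=
    V.annihilator_mono (by push_cast; omega) hk
  -- χ is split into a part in G_{-N}^⊥, a block r_{-N}, …, r_0 and a block r_1, r_2, …. The outer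
  -- parts affect neither m₀, by `h1` and `h2`, nor the pairing with the points `combo (-N) (N + 1)
  -- b`, whose digits sit in [-N, 0]. Only finite Fourier inversion on the middle block remains.
  obtain ⟨c, hc⟩ := V.exists_mul_inv_rad_mem hk'
  obtain ⟨⟨a, s⟩, rfl⟩ := (Fin.appendEquiv (N + 1) k.toNat).surjective c
  change χ * (V.rad (-N) (N + 1 + k.toNat) (Fin.append a s))⁻¹ ∈ _ at hc
  set ζ := χ * (V.rad (-N) (N + 1 + k.toNat) (Fin.append a s))⁻¹ with hζ
  have hχ : χ = ζ * (V.rad (-N) (N + 1) a * V.rad 1 k.toNat s) := by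
    rw [← hN1, ← rad_append, hζ, inv_mul_cancel_right]
  clear_value ζ
  have hm : m₀ χ = m₀ (V.rad (-N) (N + 1) a) := by rw [hχ, h1 _ hc, h2]
  have hpair : ∀ b, pairing χ (V.combo (-N) (N + 1) b) =
      pairing (V.rad (-N) (N + 1) a) (V.combo (-N) (N + 1) b) := by
    intro b
    rw [hχ, pairing_mul, pairing_mul, hc _ (V.combo_mem _ _ _), one_mul,
      V.pairing_rad_eq_one s fun k hk => V.digits_combo_of_ge b (by omega), mul_one]
  simp only [hpair, hm, maskCoeff, conj_pairing, mul_assoc, Finset.sum_mul]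
  rw [← Finset.mul_sum, Finset.sum_comm]
  simp only [← Finset.mul_sum, ← pairing_rad_sub, sum_pairing_combo, sub_eq_zero]
  rw [Finset.sum_eq_single a]
  · rw [if_pos rfl]
    field_simp
  · intro b _ hb
    rw [if_neg hb, mul_zero]
  · simp

variable [MeasurableSpace G] [BorelSpace G]
  [MeasurableSpace (Characters G)] [BorelSpace (Characters G)]
  {μ : Measure G} [μ.IsAddHaarMeasure] {ν : Measure (Characters G)} [ν.IsHaarMeasure]
  {Φ : Characters G → ℂ} {M : ℕ}

/-- The refinement equation. -/
theorem exists_refinement (hμ : μ (V.sub 0 : Set G) = 1)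
    (hν : ν (V.annihilator 0 : Set (Characters G)) = 1)
    (hinv : ∀ χ, ∀ ζ ∈ V.annihilator (-N), Φ (χ * ζ) = Φ χ)
    (hsupp : ∀ χ, χ ∉ V.annihilator M → Φ χ = 0)
    (h1 : ∀ χ ∈ V.annihilator (-N), ∀ ζ, m₀ (χ * ζ) = m₀ ζ)
    (h2 : ∀ (s : ℕ) (a : Fin s → ZMod p) (χ : Characters G), m₀ (χ * V.rad 1 s a) = m₀ χ)
    (hΦ : ∀ χ, Φ χ = m₀ χ * Φ (V.charDilation (-1) χ)) :
    ∃ c : (Fin (N + 1) → ZMod p) → ℂ, V.inverseTransform Φ (-N) (N + M) =ᵐ[μ] fun x =>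
      ∑ b, c b * V.inverseTransform Φ (-N) (N + M)
        (V.dilation 1 (x - V.combo (-N) (N + 1) b)) := by
  set f := V.inverseTransform Φ (-N) (N + M) with hf
  have hfs : ∀ x, x ∉ V.sub (-N) → f x = 0 := fun x hx => V.inverseTransform_of_notMem hx
  have hfm : MemLp f 2 μ := V.memLp_inverseTransform
  have hNM : (-N + (N + M : ℕ) : ℤ) = M := by push_cast; ring
  have hFT := V.truncFourier_inverseTransform (μ := μ) (n := N + M) hμ hinv (by rwa [hNM])
  obtain ⟨κ, hκ, hκf⟩ := V.integral_comp_dilation (μ := μ) 1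
  set u : (Fin (N + 1) → ZMod p) → G := V.combo (-N) (N + 1) with hu
  let e : (Fin (N + 1) → ZMod p) → G → ℂ := fun b x => f (V.dilation 1 (x - u b))
  have hes : ∀ b x, x ∉ V.sub (-N) → e b x = 0 := by
    intro b x hx
    refine hfs _ fun h => hx ?_
    rw [dilation_mem_iff] at h
    have := (V.sub (-N)).add_mem (V.sub_anti (by omega) h) (V.combo_mem (-N) (N + 1) b)
    rwa [← hu, sub_add_cancel] at this
  have hem : ∀ b, MemLp (e b) 2 μ := fun b =>
    (V.memLp_comp_dilation hfm 1).comp_measurePreserving (measurePreserving_sub_right μ (u b))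
  have heFT : ∀ b χ, V.truncFourier μ (e b) (-N) χ =
      κ * (conj (pairing χ (u b)) * Φ (V.charDilation (-1) χ)) := by
    intro b χ
    rw [V.truncFourier_eq_integral (hes b),
      integral_translate_mul_pairing (fun x => f (V.dilation 1 x)), ← hFT, ← hf,
      V.truncFourier_eq_integral hfs, mul_left_comm, ← hκf]
    congr 2
    funext x
    rw [pairing_charDilation, dilation_neg_dilation]
  -- The unknown dilation factor κ is divided out here. The right side then has transform m₀(χ)
  -- Φ(χ𝒜^{-1}) = Φ(χ), and both sides live on G_{-N}, so uniqueness applies.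
  refine ⟨fun b => (κ : ℂ)⁻¹ * V.maskCoeff m₀ N b, ?_⟩
  have hκ' : (κ : ℂ) ≠ 0 := Complex.ofReal_ne_zero.2 hκ
  have hsm : MemLp (fun x => ∑ b, (κ : ℂ)⁻¹ * V.maskCoeff m₀ N b * e b x) 2 μ :=
    memLp_finsetSum _ fun b _ => (hem b).const_mul _
  have hzero := V.ae_eq_zero_of_truncFourier_eq_zero hν (hfm.sub hsm) (m := -N)
    (fun x hx => by simp [hfs x hx, hes _ x hx]) fun χ => ?_
  · filter_upwards [hzero] with x hx
    exact sub_eq_zero.1 hx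
  · have hlin : V.truncFourier μ (f - fun x => ∑ b, (κ : ℂ)⁻¹ * V.maskCoeff m₀ N b * e b x) (-N) χ =
        V.truncFourier μ f (-N) χ -
          ∑ b, (κ : ℂ)⁻¹ * V.maskCoeff m₀ N b * V.truncFourier μ (e b) (-N) χ := by
      have hi : ∀ b, IntegrableOn (fun x => e b x * conj (pairing χ x)) (V.sub (-N)) μ := fun b =>
        integrableOn_mul_pairing (V.integrableOn_memLp (hem b) _) χ
      simp only [truncFourier, ← integral_const_mul]
      rw [← integral_finsetSum _ fun b _ => (hi b).const_mul _,
        ← integral_sub (integrableOn_mul_pairing (V.integrableOn_memLp hfm _) χ)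
          (integrable_finsetSum _ fun b _ => (hi b).const_mul _)]
      congr 1
      funext x
      simp only [Pi.sub_apply, sub_mul, Finset.sum_mul, mul_assoc]
    rw [hlin, hFT, hΦ, ← V.sum_maskCoeff h1 h2 χ, Finset.sum_mul, sub_eq_zero]
    refine Finset.sum_congr rfl fun b _ => ?_
    rw [heFT]
    field_simp
    rw [hu]
    ring

theorem mem_generatedSpace_one {φ : Lp ℂ 2 μ} {f : G → ℂ} (hφ : φ =ᵐ[μ] f)
    {c : (Fin (N + 1) → ZMod p) → ℂ}
    (hf : f =ᵐ[μ] fun x => ∑ b, c b * f (V.dilation 1 (x - V.combo (-N) (N + 1) b))) :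
    φ ∈ V.generatedSpace μ φ 1 := by
  set u : (Fin (N + 1) → ZMod p) → G := fun b => V.dilation 1 (V.combo (-N) (N + 1) b) with hu
  have hsum : φ = ∑ b, c b • V.dilationLp μ 1 (translateLp μ (u b) φ) := by
    have h1 : ∀ b, (c b • V.dilationLp μ 1 (translateLp μ (u b) φ) : Lp ℂ 2 μ) =ᵐ[μ]
        fun x => c b * f (V.dilation 1 (x - V.combo (-N) (N + 1) b)) := by
      intro b
      filter_upwards [V.dilationLp_ae μ 1 (translateLp μ (u b) φ),
        Lp.coeFn_smul (c b) (V.dilationLp μ 1 (translateLp μ (u b) φ)),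
        (V.quasiMeasurePreserving_dilation μ 1).ae (translateLp_ae μ (u b) φ),
        (V.quasiMeasurePreserving_dilation_sub μ 1 (u b)).ae hφ] with x h1 h2 h3 h4
      rw [h2, Pi.smul_apply, h1, h3, h4, smul_eq_mul, hu, map_sub]
    refine Lp.ext ?_
    filter_upwards [hφ, hf, ae_all_iff.2 h1, Lp.coeFn_finsetSum Finset.univ fun b =>
      c b • V.dilationLp μ 1 (translateLp μ (u b) φ)] with x h2 h3 h4 h5
    rw [h2, h3, h5, Finset.sum_apply]
    exact Finset.sum_congr rfl fun b _ => (h4 b).symm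
  have key : ∑ b, c b • V.dilationLp μ 1 (translateLp μ (u b) φ) ∈ V.generatedSpace μ φ 1 := by
    refine Submodule.sum_mem _ fun b _ => Submodule.smul_mem _ _ ?_
    -- The translations have digits in [-N, 0]; 𝒜 lowers indices by one, so all of them become
    -- negative.
    have hmem : u b ∈ V.H₀ := by
      rw [mem_H₀_iff]
      intro n hn
      rw [hu, digits_dilation]
      exact V.digits_combo_of_ge _ (by push_cast; omega)
    refine V.mem_generatedSpace hmem ?_
    filter_upwards [V.dilationLp_ae μ 1 (translateLp μ (u b) φ),
      (V.quasiMeasurePreserving_dilation μ 1).ae (translateLp_ae μ (u b) φ)] with x h1 h2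
    rw [h1, h2]
  rwa [← hsum] at key

end Refinement

/-! ### Assembling the multiresolution analysis -/

section MainConstruction

variable {p : ℕ} [Fact p.Prime] {G : Type*} [AddCommGroup G] [TopologicalSpace G]
  [IsTopologicalAddGroup G] [MeasurableSpace G] [BorelSpace G] (V : VilenkinStructure p G)
  [MeasurableSpace (Characters G)] [BorelSpace (Characters G)]
  {μ : Measure G} [μ.IsAddHaarMeasure] {ν : Measure (Characters G)} [ν.IsHaarMeasure]
  {m₀ Φ : Characters G → ℂ} {M N : ℕ}

theorem isScalingFunction_generatedSpace {φ : Lp ℂ 2 μ}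
    (h : Orthonormal ℂ fun h : V.H₀ => translateLp μ (h : G) φ) :
    V.IsScalingFunction μ (V.generatedSpace μ φ 0) φ := by
  refine ⟨_, fun h => translateLp_ae μ (h : G) φ, h, ?_⟩
  rw [generatedSpace]
  congr 2
  ext F
  simp only [Set.mem_range, Set.mem_ofPred_eq, dilation_zero, Subtype.exists]
  constructor
  · rintro ⟨h, hh, rfl⟩
    exact ⟨h, hh, translateLp_ae μ h φ⟩
  · rintro ⟨h, hh, hF⟩
    exact ⟨h, hh, Lp.ext ((translateLp_ae μ h φ).trans hF.symm)⟩

theorem generatesOrthogonalMRA (hμ : μ (V.sub 0 : Set G) = 1)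
    (hν : ν (V.annihilator 0 : Set (Characters G)) = 1)
    (hinv : ∀ χ, ∀ ζ ∈ V.annihilator (-N), Φ (χ * ζ) = Φ χ)
    (hsupp : ∀ χ, χ ∉ V.annihilator M → Φ χ = 0)
    (hone : Φ 1 = 1)
    (horth : ∀ b : Fin N → ZMod p, ∑ a : Fin M → ZMod p,
      ‖Φ (V.rad (-N) N b * V.rad 0 M a)‖ ^ 2 = 1)
    (h1 : ∀ χ ∈ V.annihilator (-N), ∀ ζ, m₀ (χ * ζ) = m₀ ζ)
    (h2 : ∀ (s : ℕ) (a : Fin s → ZMod p) (χ : Characters G), m₀ (χ * V.rad 1 s a) = m₀ χ)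
    (hΦ : ∀ χ, Φ χ = m₀ χ * Φ (V.charDilation (-1) χ)) {φ : Lp ℂ 2 μ}
    (hφ : φ =ᵐ[μ] V.inverseTransform Φ (-N) (N + M)) :
    V.GeneratesOrthogonalMRA μ φ := by
  have hscal := V.isScalingFunction_generatedSpace
    (V.orthonormal_translateLp hμ hinv hsupp horth hφ)
  obtain ⟨c, hc⟩ := V.exists_refinement hμ hν hinv hsupp h1 h2 hΦ
  have hle := V.generatedSpace_le_succ (V.mem_generatedSpace_one hφ hc)
  exact ⟨hscal,
    { isClosed := V.isClosed_generatedSpace φ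
      le_succ := hle
      dense_iUnion := V.dense_iUnion_generatedSpace (monotone_int_of_le_succ hle)
        (by omega : -(N : ℤ) ≤ 0) hφ (V.combo (-N) N)
        (fun b => V.mem_H₀_iff.2 fun k hk => V.digits_combo_of_ge b (by omega))
        (V.sum_inverseTransform_translate hone horth)
      iInf_eq_bot := V.iInf_generatedSpace hμ hφ fun x _ hy => V.inverseTransform_add x hy
      dilation_iff := V.memSubspace_dilation_iff
      shift_mem := fun f hf h hh => V.memSubspace_shift hf hh
      exists_scaling := ⟨φ, hscal⟩ }⟩

end MainConstruction

end VilenkinStructure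


theorem theorem4p4 {p : ℕ} [Fact p.Prime] {G : Type*} [AddCommGroup G] [TopologicalSpace G]
    [IsTopologicalAddGroup G] [MeasurableSpace G] [BorelSpace G]
    (V : VilenkinStructure p G)
    [MeasurableSpace (VilenkinStructure.Characters G)]
    [BorelSpace (VilenkinStructure.Characters G)]
    -- the Haar measures on the group and on its group of characters
    (μ : Measure G) [μ.IsAddHaarMeasure] (hμ : μ (V.sub 0 : Set G) = 1)
    (ν : Measure (VilenkinStructure.Characters G)) [ν.IsHaarMeasure]
    (hν : ν (V.annihilator 0 : Set (VilenkinStructure.Characters G)) = 1)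
    (M N : ℕ) (m₀ Φ : VilenkinStructure.Characters G → ℂ)
    -- the mask is constant on the cosets of the annihilator with index -N
    (hT1 : ∀ χ ∈ V.annihilator (-N), ∀ ζ, m₀ (χ * ζ) = m₀ ζ)
    -- the mask is periodic with any period r_1^α_1 ⋯ r_s^α_s
    (hT2 : ∀ (s : ℕ) (α : Fin s → Fin p) (χ : VilenkinStructure.Characters G),
      m₀ (χ * ∏ j : Fin s, V.rademacher ((j : ℕ) + 1) ^ (α j : ℕ)) = m₀ χ)
    -- the mask equals 1 on the annihilator with index -N
    (hT3 : ∀ χ ∈ V.annihilator (-N), m₀ χ = 1)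
    -- the product vanishes on the difference of two consecutive annihilators
    (hvanish : ∀ χ ∈ V.annihilator (M + 1), χ ∉ V.annihilator M →
      ∏ n ∈ Finset.range (M + N + 1), m₀ (V.charDilation (-n) χ) = 0)
    -- the Fourier transform of the refinable function
    (hΦ : ∀ χ, Φ χ = ∏' n : ℕ, m₀ (V.charDilation (-n) χ))
    -- the orthonormality condition
    (horth : ∀ β : Fin N → Fin p, ∑ α : Fin M → Fin p,
      ‖Φ ((∏ j : Fin N, V.rademacher (-N + (j : ℕ)) ^ (β j : ℕ)) *
        ∏ j : Fin M, V.rademacher (j : ℕ) ^ (α j : ℕ))‖ ^ 2 = 1) :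
    (∃! φ : Lp ℂ 2 μ, V.IsFourierTransform μ ν φ Φ) ∧
      ∀ φ : Lp ℂ 2 μ, V.IsFourierTransform μ ν φ Φ →
        φ ∈ V.stepFunctions μ M N ∧ V.GeneratesOrthogonalMRA μ φ := by
  have hinv : ∀ χ, ∀ ζ ∈ V.annihilator (-N), Φ (χ * ζ) = Φ χ := fun χ ζ hζ => by
    rw [hΦ, hΦ]
    exact V.maskProduct_mul hT1 χ hζ
  have hsupp : ∀ χ, χ ∉ V.annihilator M → Φ χ = 0 := fun χ hχ => by
    rw [hΦ]
    exact V.maskProduct_eq_zero hT3 hvanish hχ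
  have hone : Φ 1 = 1 := by
    rw [hΦ]
    exact V.maskProduct_eq_one hT3 (one_mem _)
  have hrefine : ∀ χ, Φ χ = m₀ χ * Φ (V.charDilation (-1) χ) := fun χ => by
    rw [hΦ, hΦ]
    exact V.maskProduct_refinement hT3 χ
  have hper : ∀ (s : ℕ) (a : Fin s → ZMod p) (χ : VilenkinStructure.Characters G),
      m₀ (χ * V.rad 1 s a) = m₀ χ := fun s a χ => by
    rw [← hT2 s (fun j => VilenkinStructure.zmodEquivFin p (a j)) χ]
    simp only [VilenkinStructure.rad, add_comm (1 : ℤ)]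
    rfl
  have hsum : ∀ b : Fin N → ZMod p, ∑ a : Fin M → ZMod p,
      ‖Φ (V.rad (-N) N b * V.rad 0 M a)‖ ^ 2 = 1 := fun b => by
    rw [← horth fun j => VilenkinStructure.zmodEquivFin p (b j),
      ← (Equiv.piCongrRight fun _ : Fin M => VilenkinStructure.zmodEquivFin p).sum_comp]
    simp only [VilenkinStructure.rad, zero_add]
    rfl
  have hNM : (-N + (N + M : ℕ) : ℤ) = M := by push_cast; ring
  have hsupp' : ∀ χ, χ ∉ V.annihilator (-N + (N + M : ℕ)) → Φ χ = 0 := by rwa [hNM]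
  have hmem : MemLp (V.inverseTransform Φ (-N) (N + M)) 2 μ := V.memLp_inverseTransform
  have hFT : V.IsFourierTransform μ ν (V.inverseTransform Φ (-N) (N + M)) Φ :=
    V.isFourierTransform_of_support hmem (V.memLp_of_support hν hinv hsupp')
      (fun _ hx => V.inverseTransform_of_notMem hx)
      (V.truncFourier_inverseTransform hμ hinv hsupp')
  -- Uniqueness identifies any such φ with the explicit step function, so every remaining claim is
  -- checked on that function.
  have hae : ∀ φ : Lp ℂ 2 μ, V.IsFourierTransform μ ν φ Φ →
      φ =ᵐ[μ] V.inverseTransform Φ (-N) (N + M) := fun φ hφ => hφ.ae_eq hν hFT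
  refine ⟨⟨hmem.toLp _, hFT.congr_ae hmem.coeFn_toLp.symm, fun φ hφ => ?_⟩, fun φ hφ => ⟨?_, ?_⟩⟩
  · exact Lp.ext ((hae φ hφ).trans hmem.coeFn_toLp.symm)
  · refine ⟨_, hae φ hφ, fun x hx => V.inverseTransform_of_notMem hx, fun x y hy => ?_⟩
    exact V.inverseTransform_add x (by rwa [hNM])
  · exact V.generatesOrthogonalMRA hμ hν hinv hsupp hone hsum hT1 hper hrefine (hae φ hφ)
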